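/- Let $\Sigma$ be a closed smooth surface (a compact Hausdorff smooth $2$-manifold without boundary, for instance $S^2$), let $1\le p<\infty$, and let $n,N\ge 0$ be integers. For an integer $k\ge 0$ let $L^p_k(\Sigma,\mathbf R^N)$ be the Sobolev space of (a.e.-classes of) functions $\Sigma\to\mathbf R^N$ with $k$ weak derivatives in $L^p$, normed by means of any finite smooth atlas $(e_i)$ with a subordinate smooth partition of unity $(\rho_i)$: $$\|\xi\|_{k,p}=\Big(\sum_i\sum_{j\le k}\ \sum_{w\in\{1,2\}^j}\int_{\mathbf R^2}\big|\partial_{w_1}\cdots\partial_{w_j}\big((\rho_i\xi)\circ e_i^{-1}\big)\big|^p\,dx\Big)^{1/p},$$ where $(\rho_i\xi)\circ e_i^{-1}$ is extended by zero. Different choices give equivalent norms. Let $G_e=B^n_\varepsilon$ be the open ball of radius $\varepsilon>0$ about $0$ in $\mathbf R^n$, and let $\phi:G_e\times\Sigma\to\Sigma$ be a $C^\infty$ map such that $\phi_\gamma=\phi(\gamma,\cdot)$ is a diffeomorphism of $\Sigma$ for every $\gamma\in G_e$ ($\phi$ need not be a group action or a local group action). Then for all integers $k,m\ge 0$ the action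 map $\Phi(\gamma,\xi)=\xi\circ\phi_\gamma$ is well defined as a map $$\Phi_m:G_e\times L^p_{k+m}(\Sigma,\mathbf R^N)\to L^p_k(\Sigma,\mathbf R^N)$$ and is of class $C^m$. In particular (shifting the index $k$), for all integers $k,m\ge0$ with $k-m-2/p>0$ the map $\Phi_m:G_e\times L^p_k(\Sigma,\mathbf R^N)\to L^p_{k-m}(\Sigma,\mathbf R^N)$, $(\gamma,\xi)\mapsto\xi\circ\phi_\gamma$, is of class $C^m$. -/

import Mathlib

open MeasureTheory Set
open scoped Manifold ContDiff ENNReal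

noncomputable section

/-- The model plane. -/
abbrev Plane : Type := EuclideanSpace ℝ (Fin 2)

/-- `g` is the weak partial derivative `∂_{w 0} ⋯ ∂_{w (j-1)} u` on the plane, tested against
all compactly supported smooth functions. (It is only used for `u`, `g` in `L^p`.) -/
def HasWeakPartial {E : Type*} [NormedAddCommGroup E] [NormedSpace ℝ E] {j : ℕ}
    (w : Fin j → Fin 2) (u g : Plane → E) : Prop :=
  ∀ θ : Plane → ℝ, ContDiff ℝ ∞ θ → HasCompactSupport θ →
    ∫ x, (iteratedFDeriv ℝ j θ x fun l => EuclideanSpace.single (w l) (1 : ℝ)) • u x =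
      (-1 : ℝ) ^ j • ∫ x, θ x • g x

/-- `u` belongs to `W^{k,p}` of the plane: `u` is in `L^p` and so are all its weak partial
derivatives of order at most `k`. -/
def MemPlaneSobolev {E : Type*} [NormedAddCommGroup E] [NormedSpace ℝ E]
    (k : ℕ) (p : ℝ≥0∞) (u : Plane → E) : Prop :=
  MemLp u p volume ∧ ∀ j ≤ k, ∀ w : Fin j → Fin 2,
    ∃ g : Plane → E, MemLp g p volume ∧ HasWeakPartial w u g

/-- A finite family of smooth charts of a surface together with a smooth partition of unity
subordinate to the chart domains (which therefore cover the surface). -/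
structure SobolevAtlas (M : Type*) [TopologicalSpace M] [ChartedSpace Plane M] where
  /-- number of charts -/
  card : ℕ
  /-- the charts -/
  chart : Fin card → OpenPartialHomeomorph M Plane
  chart_mem : ∀ i, chart i ∈ IsManifold.maximalAtlas (𝓡 2) ∞ M
  /-- the partition of unity -/
  weight : SmoothPartitionOfUnity (Fin card) (𝓡 2) M univ
  subordinate : weight.IsSubordinate fun i => (chart i).source

namespace SobolevAtlas

variable {M : Type*} [TopologicalSpace M] [ChartedSpace Plane M] [MeasurableSpace M]

/-- The `i`-th part `ρ_i · (e_i⁻¹)_* (dx₁ dx₂)` of the measure of the atlas. -/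
def localMeasure (D : SobolevAtlas M) (i : Fin D.card) : Measure M :=
  ((volume.restrict (D.chart i).target).map (D.chart i).symm).withDensity
    fun y => ENNReal.ofReal (D.weight i y)

/-- The measure `∑ i, ρ_i · (e_i⁻¹)_* (dx₁ dx₂)`: a measure with smooth positive density in every
chart. It serves only to speak about functions up to null sets. -/
def measure (D : SobolevAtlas M) : Measure M := Measure.sum D.localMeasure

/-- The localized function `(ρ_i u) ∘ e_i⁻¹`, extended by zero to the whole plane. -/
def localRep {M : Type*} [TopologicalSpace M] [ChartedSpace Plane M] (D : SobolevAtlas M)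
    {E : Type*} [AddCommGroup E] [Module ℝ E] (i : Fin D.card) (u : M → E) : Plane → E :=
  (D.chart i).target.indicator fun x =>
    D.weight i ((D.chart i).symm x) • u ((D.chart i).symm x)

end SobolevAtlas

section Facts

variable {E : Type*} [NormedAddCommGroup E] [NormedSpace ℝ E]

theorem integrable_test_smul {p : ℝ≥0∞} (hp : 1 ≤ p) {θ : Plane → ℝ} (hθ : Continuous θ)
    (hc : HasCompactSupport θ) {g : Plane → E} (hg : MemLp g p volume) :
    Integrable (fun x => θ x • g x) volume :=
  (hg.locallyIntegrable hp).integrable_smul_left_of_hasCompactSupport hθ hc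

theorem continuous_test_deriv {j : ℕ} (w : Fin j → Fin 2) {θ : Plane → ℝ}
    (hθ : ContDiff ℝ ∞ θ) :
    Continuous fun x => iteratedFDeriv ℝ j θ x fun l => EuclideanSpace.single (w l) (1 : ℝ) :=
  (ContinuousMultilinearMap.apply ℝ (fun _ : Fin j => Plane) ℝ
    (fun l => EuclideanSpace.single (w l) (1 : ℝ))).continuous.comp
    (hθ.continuous_iteratedFDeriv (by exact_mod_cast le_top))

theorem compact_test_deriv {j : ℕ} (w : Fin j → Fin 2) {θ : Plane → ℝ}
    (hc : HasCompactSupport θ) :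
    HasCompactSupport
      fun x => iteratedFDeriv ℝ j θ x fun l => EuclideanSpace.single (w l) (1 : ℝ) :=
  (hc.iteratedFDeriv (𝕜 := ℝ) j).comp_left
    (g := fun T : ContinuousMultilinearMap ℝ (fun _ : Fin j => Plane) ℝ =>
      T fun l => EuclideanSpace.single (w l) (1 : ℝ)) rfl

theorem HasWeakPartial.add {p : ℝ≥0∞} (hp : 1 ≤ p) {j : ℕ} {w : Fin j → Fin 2}
    {u g u' g' : Plane → E} (hu : MemLp u p volume) (hg : MemLp g p volume)
    (hu' : MemLp u' p volume) (hg' : MemLp g' p volume)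
    (h : HasWeakPartial w u g) (h' : HasWeakPartial w u' g') :
    HasWeakPartial w (u + u') (g + g') := by
  intro θ hθ hc
  have c1 := continuous_test_deriv w hθ
  have c2 := compact_test_deriv w hc
  simp only [Pi.add_apply, smul_add]
  rw [integral_add (integrable_test_smul hp c1 c2 hu) (integrable_test_smul hp c1 c2 hu'),
    integral_add (integrable_test_smul hp hθ.continuous hc hg)
      (integrable_test_smul hp hθ.continuous hc hg'), h θ hθ hc, h' θ hθ hc, smul_add]

theorem HasWeakPartial.const_smul {j : ℕ} {w : Fin j → Fin 2} {u g : Plane → E} (c : ℝ)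
    (h : HasWeakPartial w u g) : HasWeakPartial w (c • u) (c • g) := by
  intro θ hθ hc
  simp only [Pi.smul_apply, smul_comm _ c, integral_smul]
  rw [h θ hθ hc]

theorem HasWeakPartial.congr {j : ℕ} {w : Fin j → Fin 2} {u g u' : Plane → E}
    (h : HasWeakPartial w u g) (hu : u =ᵐ[volume] u') : HasWeakPartial w u' g := by
  intro θ hθ hc
  rw [← h θ hθ hc]
  refine integral_congr_ae ?_
  filter_upwards [hu] with x hx
  rw [hx]

theorem HasWeakPartial.unique [CompleteSpace E] {p : ℝ≥0∞} (hp : 1 ≤ p) {j : ℕ}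
    {w : Fin j → Fin 2}
    {u g g' : Plane → E} (hg : MemLp g p volume) (hg' : MemLp g' p volume)
    (h : HasWeakPartial w u g) (h' : HasWeakPartial w u g') : g =ᵐ[volume] g' := by
  refine ae_eq_of_integral_contDiff_smul_eq (hg.locallyIntegrable hp) (hg'.locallyIntegrable hp)
    fun θ hθ hc => ?_
  have e := (h θ hθ hc).symm.trans (h' θ hθ hc)
  have hne : ((-1 : ℝ) ^ j) ≠ 0 := pow_ne_zero _ (by norm_num)
  exact smul_right_injective E hne e

/-- The derivative of order zero is the function itself. -/
theorem hasWeakPartial_zero (w : Fin 0 → Fin 2) (u : Plane → E) : HasWeakPartial w u u := by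
  intro θ _ _
  simp

theorem MemPlaneSobolev.add {p : ℝ≥0∞} (hp : 1 ≤ p) {k : ℕ} {u v : Plane → E}
    (hu : MemPlaneSobolev k p u) (hv : MemPlaneSobolev k p v) : MemPlaneSobolev k p (u + v) := by
  refine ⟨hu.1.add hv.1, fun j hj w => ?_⟩
  obtain ⟨g, hg, h⟩ := hu.2 j hj w
  obtain ⟨g', hg', h'⟩ := hv.2 j hj w
  exact ⟨g + g', hg.add hg', h.add hp hu.1 hg hv.1 hg' h'⟩

theorem MemPlaneSobolev.const_smul {p : ℝ≥0∞} {k : ℕ} {u : Plane → E} (c : ℝ)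
    (hu : MemPlaneSobolev k p u) : MemPlaneSobolev k p (c • u) := by
  refine ⟨hu.1.const_smul c, fun j hj w => ?_⟩
  obtain ⟨g, hg, h⟩ := hu.2 j hj w
  exact ⟨c • g, hg.const_smul c, h.const_smul c⟩

theorem MemPlaneSobolev.congr {p : ℝ≥0∞} {k : ℕ} {u v : Plane → E}
    (hu : MemPlaneSobolev k p u) (huv : u =ᵐ[volume] v) : MemPlaneSobolev k p v := by
  refine ⟨hu.1.ae_eq huv, fun j hj w => ?_⟩
  obtain ⟨g, hg, h⟩ := hu.2 j hj w
  exact ⟨g, hg, h.congr huv⟩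

variable {M : Type*} [TopologicalSpace M] [ChartedSpace Plane M]

theorem localRep_add (D : SobolevAtlas M) (i : Fin D.card) (u v : M → E) :
    D.localRep i (u + v) = D.localRep i u + D.localRep i v := by
  funext x
  by_cases hx : x ∈ (D.chart i).target <;> simp [SobolevAtlas.localRep, hx]

theorem localRep_smul (D : SobolevAtlas M) (i : Fin D.card) (c : ℝ) (u : M → E) :
    D.localRep i (c • u) = c • D.localRep i u := by
  funext x
  by_cases hx : x ∈ (D.chart i).target <;> simp [SobolevAtlas.localRep, hx, smul_comm _ c]

theorem localRep_zero (D : SobolevAtlas M) (i : Fin D.card) :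
    D.localRep i (0 : M → E) = 0 := by
  funext x
  simp [SobolevAtlas.localRep]

variable [MeasurableSpace M] [BorelSpace M]

theorem aemeasurable_chart_symm (D : SobolevAtlas M) (i : Fin D.card) :
    AEMeasurable (D.chart i).symm (volume.restrict (D.chart i).target) :=
  (D.chart i).continuousOn_symm.aemeasurable (D.chart i).open_target.measurableSet

theorem measurable_weight (D : SobolevAtlas M) (i : Fin D.card) :
    Measurable fun y => ENNReal.ofReal (D.weight i y) :=
  (D.weight i).contMDiff.continuous.measurable.ennreal_ofReal

theorem localRep_congr (D : SobolevAtlas M) (i : Fin D.card) {u v : M → E}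
    (h : u =ᵐ[D.measure] v) : D.localRep i u =ᵐ[volume] D.localRep i v := by
  have h1 := (Measure.ae_sum_iff.1 h) i
  have h2 := (ae_withDensity_iff (measurable_weight D i)).1 h1
  have h3 := (ae_restrict_iff' (D.chart i).open_target.measurableSet).1
    (ae_of_ae_map (aemeasurable_chart_symm D i) h2)
  filter_upwards [h3] with x hx
  by_cases hxt : x ∈ (D.chart i).target
  · simp only [SobolevAtlas.localRep, hxt, indicator_of_mem]
    by_cases h0 : D.weight i ((D.chart i).symm x) = 0
    · simp [h0]
    · have hpos : 0 < D.weight i ((D.chart i).symm x) :=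
        lt_of_le_of_ne (D.weight.nonneg i _) (Ne.symm h0)
      rw [hx hxt (ENNReal.ofReal_pos.2 hpos).ne']
  · simp [SobolevAtlas.localRep, hxt]

theorem ae_eq_zero_of_localRep (D : SobolevAtlas M) {u : M → E} (hu : StronglyMeasurable u)
    (h : ∀ i, D.localRep i u =ᵐ[volume] 0) : u =ᵐ[D.measure] 0 := by
  refine Measure.ae_sum_iff.2 fun i => ?_
  refine (ae_withDensity_iff (measurable_weight D i)).2 ?_
  have hm : MeasurableSet {y | ENNReal.ofReal (D.weight i y) ≠ 0 → u y = (0 : M → E) y} := by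
    have h1 : MeasurableSet {y | ENNReal.ofReal (D.weight i y) = 0} :=
      measurable_weight D i (measurableSet_singleton 0)
    have h2 : MeasurableSet {y | u y = 0} := hu.measurableSet_eq_fun stronglyMeasurable_const
    convert h1.union h2 using 1
    ext y
    simp only [mem_ofPred_eq, mem_union, Pi.zero_apply]
    tauto
  rw [ae_map_iff (aemeasurable_chart_symm D i) hm,
    ae_restrict_iff' (D.chart i).open_target.measurableSet]
  filter_upwards [h i] with x hx hxt hne
  simp only [SobolevAtlas.localRep, hxt, indicator_of_mem, Pi.zero_apply] at hx
  rcases smul_eq_zero.1 hx with h0 | h0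
  · exact absurd (by simp [h0]) hne
  · exact h0

end Facts

section Space

variable {M : Type*} [TopologicalSpace M] [ChartedSpace Plane M]
  [MeasurableSpace M] [BorelSpace M]

/-- The a.e.-classes of functions `u : M → E` all of whose localizations `(ρ_i u) ∘ e_i⁻¹` are in
`W^{k,p}` of the plane. -/
def sobolevSubmodule (D : SobolevAtlas M) (E : Type*) [NormedAddCommGroup E] [NormedSpace ℝ E]
    (k : ℕ) (p : ℝ≥0∞) [hp : Fact (1 ≤ p)] : Submodule ℝ (M →ₘ[D.measure] E) where
  carrier := {u | ∀ i, MemPlaneSobolev k p (D.localRep i u)}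
  zero_mem' i := by
    refine MemPlaneSobolev.congr (u := 0) ⟨MemLp.zero, fun j _ w => ⟨0, MemLp.zero, ?_⟩⟩ ?_
    · intro θ _ _
      simp
    · have := localRep_congr (E := E) D i (AEEqFun.coeFn_zero (μ := D.measure))
      rw [localRep_zero] at this
      exact this.symm
  add_mem' {u v} hu hv i := by
    refine ((hu i).add hp.out (hv i)).congr ?_
    rw [← localRep_add]
    exact (localRep_congr D i (AEEqFun.coeFn_add u v)).symm
  smul_mem' c u hu i := by
    refine ((hu i).const_smul c).congr ?_
    rw [← localRep_smul]
    exact (localRep_congr D i (AEEqFun.coeFn_smul c u)).symm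

/-- The Sobolev space `L^p_k(M, E)` of functions with `k` weak derivatives in `L^p`. -/
def SobolevSpace (D : SobolevAtlas M) (E : Type*) [NormedAddCommGroup E] [NormedSpace ℝ E]
    (k : ℕ) (p : ℝ≥0∞) [Fact (1 ≤ p)] : Type _ := sobolevSubmodule D E k p

namespace SobolevSpace

variable (D : SobolevAtlas M) (E : Type*) [NormedAddCommGroup E] [NormedSpace ℝ E]
  (k : ℕ) (p : ℝ≥0∞) [hp : Fact (1 ≤ p)]

instance : AddCommGroup (SobolevSpace D E k p) :=
  inferInstanceAs (AddCommGroup (sobolevSubmodule D E k p))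

instance : Module ℝ (SobolevSpace D E k p) :=
  inferInstanceAs (Module ℝ (sobolevSubmodule D E k p))

variable {D E k p}

/-- The underlying a.e.-class. -/
def toAEEqFun (u : SobolevSpace D E k p) : M →ₘ[D.measure] E := u.1

/-- An element is used as a function `M → E` (a representative of its a.e.-class). -/
instance : CoeFun (SobolevSpace D E k p) fun _ => M → E := ⟨fun u => u.toAEEqFun⟩

theorem mem (u : SobolevSpace D E k p) (i : Fin D.card) : MemPlaneSobolev k p (D.localRep i u) :=
  u.2 i

variable (k) in
/-- The sequences of at most `k` coordinate directions. -/
abbrev Word : Type := Σ j : Fin (k + 1), Fin j → Fin 2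

/-- The weak partial derivative `∂_w ((ρ_i u) ∘ e_i⁻¹)` as an element of `L^p` of the plane. -/
def partialLp (u : SobolevSpace D E k p) (a : Fin D.card × Word k) :
    Lp E p (volume : Measure Plane) :=
  ((u.mem a.1).2 a.2.1 (Nat.lt_succ_iff.1 a.2.1.2) a.2.2).choose_spec.1.toLp

theorem partialLp_spec (u : SobolevSpace D E k p) (a : Fin D.card × Word k) :
    HasWeakPartial a.2.2 (D.localRep a.1 u) (u.partialLp a) := by
  have h := ((u.mem a.1).2 a.2.1 (Nat.lt_succ_iff.1 a.2.1.2) a.2.2).choose_spec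
  intro θ hθ hc
  rw [h.2 θ hθ hc]
  congr 1
  refine integral_congr_ae ?_
  filter_upwards [h.1.coeFn_toLp] with x hx
  rw [partialLp, hx]

theorem partialLp_eq [CompleteSpace E] (u : SobolevSpace D E k p) (a : Fin D.card × Word k)
    {g : Plane → E} (hg : MemLp g p volume) (h : HasWeakPartial a.2.2 (D.localRep a.1 u) g) :
    (u.partialLp a : Plane → E) =ᵐ[volume] g :=
  (u.partialLp_spec a).unique hp.out (Lp.memLp _) hg h

variable [CompleteSpace E]

variable (D E k p) in
/-- All weak partial derivatives of order at most `k` of all the localizations of `u`, collected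
in the `ℓ^p`-sum of copies of `L^p` of the plane. -/
def jet : SobolevSpace D E k p →ₗ[ℝ]
    PiLp p fun _ : Fin D.card × Word k => Lp E p (volume : Measure Plane) where
  toFun u := WithLp.toLp p fun a => u.partialLp a
  map_add' u v := by
    ext1 a
    refine Lp.ext ?_
    refine (partialLp_eq (u + v) a ((Lp.memLp (u.partialLp a)).add (Lp.memLp (v.partialLp a)))
      ?_).trans (Lp.coeFn_add _ _).symm
    refine ((u.partialLp_spec a).add hp.out (u.mem a.1).1 (Lp.memLp _) (v.mem a.1).1 (Lp.memLp _)
      (v.partialLp_spec a)).congr ?_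
    rw [← localRep_add]
    exact (localRep_congr D a.1 (AEEqFun.coeFn_add u.1 v.1)).symm
  map_smul' c u := by
    ext1 a
    refine Lp.ext ?_
    refine (partialLp_eq (c • u) a ((Lp.memLp (u.partialLp a)).const_smul c) ?_).trans
      (Lp.coeFn_smul c _).symm
    refine ((u.partialLp_spec a).const_smul c).congr ?_
    rw [← localRep_smul]
    exact (localRep_congr D a.1 (AEEqFun.coeFn_smul c u.1)).symm

theorem jet_injective : Function.Injective (jet D E k p) := by
  refine (injective_iff_map_eq_zero _).2 fun u hu => ?_
  have key : ∀ i, D.localRep i u =ᵐ[volume] 0 := by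
    intro i
    let a : Fin D.card × Word k := (i, ⟨⟨0, Nat.succ_pos k⟩, Fin.elim0⟩)
    have h0 : u.partialLp a = 0 := congrArg (fun z => z.ofLp a) hu
    have h1 := partialLp_eq u a (u.mem i).1 (hasWeakPartial_zero _ _)
    rw [h0] at h1
    exact h1.symm.trans (Lp.coeFn_zero E p volume)
  refine Subtype.ext ?_
  exact AEEqFun.ext ((ae_eq_zero_of_localRep D u.1.stronglyMeasurable key).trans
    AEEqFun.coeFn_zero.symm)

/-- The Sobolev norm `‖u‖ = (∑_i ∑_{|w| ≤ k} ‖∂_w ((ρ_i u) ∘ e_i⁻¹)‖_p ^ p) ^ (1/p)`. -/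
instance : NormedAddCommGroup (SobolevSpace D E k p) :=
  NormedAddCommGroup.induced _ _ (jet D E k p) jet_injective

instance : NormedSpace ℝ (SobolevSpace D E k p) :=
  NormedSpace.induced ℝ _ _ (jet D E k p)

end SobolevSpace

/-- `Φ` is the action map `(γ, ξ) ↦ ξ ∘ φ_γ` for parameters `γ ∈ G`, from `L^p_k` to `L^p_l`. In
particular all the compositions `ξ ∘ φ_γ` are in `L^p_l`; on `G × L^p_k` the map `Φ` is uniquely
determined by this property. -/
def IsActionMap (D : SobolevAtlas M) {X E : Type*} [NormedAddCommGroup E] [NormedSpace ℝ E]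
    {k l : ℕ} {p : ℝ≥0∞} [Fact (1 ≤ p)] (G : Set X) (φ : X → M → M)
    (Φ : X × SobolevSpace D E k p → SobolevSpace D E l p) : Prop :=
  ∀ γ ∈ G, ∀ ξ : SobolevSpace D E k p, Φ (γ, ξ) =ᵐ[D.measure] fun x => ξ (φ γ x)

end Space

end

/-!
The surface enters only through a finite atlas. If `ρ_j` is the partition of unity, then in the
`i`-th chart `ξ ∘ φ_γ` is the finite sum over `j` of the functions
`x ↦ b (γ, x) • u_j (ψ (γ, x))`, where `u_j` is the `j`-th localization of `ξ`, `ψ` is the map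
`φ` read in the charts `i` and `j`, and the weight `b` is `ρ_i` times the pullback of a cutoff
function which equals one on the support of `ρ_j` (`exists_planeFamily`). So the claim is about
weighted composition operators on the plane, which are studied for an abstract `PlaneFamily`.

* The change of variables formula bounds these operators on `L^p`, locally uniformly in `γ`
  (`IsWeight.exists_eLpNorm_pull_le`).
* For smooth `u` the curve `γ ↦ b (γ, ·) • u (ψ (γ, ·))` is differentiable in `L^p`, and its
  partial derivatives, in the parameter or in the plane, are again sums of weighted compositions:
  of `u`, with the derivative of `b` as weight, and of the partial derivatives of `u`. Mollification
  and the uniform bound carry this over to `u` in `W^{1,p}` (`IsWeight.hasFDerivAt_pull`,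
  `IsWeight.hasWeakDeriv_pull`). By induction, each `γ`-derivative costs one derivative of `u`, so
  that for `u` in `W^{k+m,p}` the weak derivatives of order at most `k` of the composition are `C^m`
  curves in `L^p` (`IsWeight.exists_contDiffOn_hasWeakPartial`).
* Hence `γ ↦ ξ ∘ φ_γ` is of class `C^m` into `L^p_k` for every fixed `ξ` in `L^p_{k+m}`. Each
  `ξ ↦ ξ ∘ φ_γ` is a bounded operator, by the closed graph theorem and the completeness of the
  Sobolev spaces.
* A family of bounded operators `T_γ` on a Banach space all of whose orbits `γ ↦ T_γ ξ` are of
  class `C^m` gives a map `(γ, ξ) ↦ T_γ ξ` of class `C^m`: by the uniform boundedness principle the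
  derivatives of the orbits are again given by families of bounded operators, and for `m = 1` the
  mean value inequality makes the family locally Lipschitz in the operator norm
  (`contDiffOn_prod_apply`).

The second claim is the first one with the index shifted, as `k - m - 2 / p > 0` gives `m ≤ k`.
-/

open Filter Topology
open scoped Convolution

set_option linter.unusedSectionVars false

/-! ### Families of operators that are smooth in the strong sense -/

section StrongFamilies

variable {F X Y : Type*} [NormedAddCommGroup F] [NormedSpace ℝ F]
  [NormedAddCommGroup X] [NormedSpace ℝ X] [NormedAddCommGroup Y] [NormedSpace ℝ Y]

theorem contDiffOn_succ_of_hasFDerivAt {f : F → Y} {f' : F → F →L[ℝ] Y} {G : Set F}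
    (hG : IsOpen G) {m : ℕ} (hf : ∀ x ∈ G, HasFDerivAt f (f' x) x) (hf' : ContDiffOn ℝ m f' G) :
    ContDiffOn ℝ (m + 1 : ℕ) f G := by
  push_cast
  refine (contDiffOn_succ_iff_fderiv_of_isOpen hG).2
    ⟨fun x hx => (hf x hx).differentiableAt.differentiableWithinAt, by simp, ?_⟩
  exact hf'.congr fun x hx => (hf x hx).fderiv

theorem exists_forall_norm_le_of_continuousOn_apply [CompleteSpace X] {T : F → X →L[ℝ] Y}
    {K : Set F} (hK : IsCompact K) (h : ∀ ξ, ContinuousOn (fun γ => T γ ξ) K) :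
    ∃ C, 0 ≤ C ∧ ∀ γ ∈ K, ‖T γ‖ ≤ C := by
  obtain ⟨C, hC⟩ := banach_steinhaus (g := fun γ : K => T γ) fun ξ => by
    obtain ⟨C, hC⟩ := hK.exists_bound_of_continuousOn (h ξ)
    exact ⟨C, fun γ => hC γ γ.2⟩
  exact ⟨max C 0, le_max_right _ _, fun γ hγ => (hC ⟨γ, hγ⟩).trans (le_max_left _ _)⟩

/-- A strongly continuous family of operators is jointly continuous, since it is locally bounded by
the Banach–Steinhaus theorem. -/
theorem continuousOn_prod_apply [FiniteDimensional ℝ F] [CompleteSpace X] {T : F → X →L[ℝ] Y}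
    {G : Set F} (hG : IsOpen G) (h : ∀ ξ, ContinuousOn (fun γ => T γ ξ) G) :
    ContinuousOn (fun z : F × X => T z.1 z.2) (G ×ˢ univ) := by
  rintro ⟨γ, ξ⟩ ⟨hγ, -⟩
  refine ContinuousAt.continuousWithinAt ?_
  obtain ⟨r, hr, hrG⟩ := Metric.nhds_basis_closedBall.mem_iff.1 (hG.mem_nhds hγ)
  obtain ⟨C, hC0, hC⟩ := exists_forall_norm_le_of_continuousOn_apply
    (isCompact_closedBall γ r) fun ξ => (h ξ).mono hrG
  have h1 : Tendsto (fun z : F × X => C * ‖z.2 - ξ‖ + ‖T z.1 ξ - T γ ξ‖) (𝓝 (γ, ξ)) (𝓝 0) := by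
    have hc : ContinuousAt (fun z : F × X => C * ‖z.2 - ξ‖ + ‖T z.1 ξ - T γ ξ‖) (γ, ξ) := by
      have : ContinuousAt (fun z : F × X => T z.1 ξ) (γ, ξ) :=
        ContinuousAt.comp (f := Prod.fst) (g := fun γ => T γ ξ)
          ((h ξ).continuousAt (hG.mem_nhds hγ)) continuousAt_fst
      exact (continuousAt_const.mul (continuousAt_snd.sub continuousAt_const).norm).add
        (this.sub continuousAt_const).norm
    simpa [ContinuousAt] using hc
  refine tendsto_iff_norm_sub_tendsto_zero.2 (squeeze_zero' (.of_forall fun _ => norm_nonneg _)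
    ?_ h1)
  have hnear : ∀ᶠ z : F × X in 𝓝 (γ, ξ), z.1 ∈ Metric.closedBall γ r :=
    continuousAt_fst.eventually (Metric.closedBall_mem_nhds γ hr)
  filter_upwards [hnear] with z hz
  have e : T z.1 z.2 - T γ ξ = T z.1 (z.2 - ξ) + (T z.1 ξ - T γ ξ) := by
    rw [map_sub]; abel
  rw [e]
  refine (norm_add_le _ _).trans (add_le_add_left ?_ _)
  exact ((T z.1).le_opNorm _).trans (by gcongr; exact hC _ hz)

/-- The derivatives of a strongly differentiable family of operators form again a family of bounded
operators, by the Banach–Steinhaus theorem. -/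
theorem exists_family_hasFDerivAt_apply [FiniteDimensional ℝ F] [CompleteSpace X]
    {T : F → X →L[ℝ] Y} {G : Set F} (h : ∀ ξ, ∀ γ ∈ G, DifferentiableAt ℝ (fun γ => T γ ξ) γ) :
    ∃ T' : F → X →L[ℝ] F →L[ℝ] Y, ∀ γ ∈ G, ∀ ξ, HasFDerivAt (fun γ => T γ ξ) (T' γ ξ) γ := by
  have key : ∀ γ ∈ G, ∃ A : X →L[ℝ] F →L[ℝ] Y, ∀ ξ, HasFDerivAt (fun γ => T γ ξ) (A ξ) γ := by
    intro γ hγ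
    -- the directional derivatives are strong limits of bounded operators
    have hlim : ∀ v : F, Tendsto (fun (c : ℝ) ξ => (c • (T (γ + c⁻¹ • v) - T γ)) ξ) atTop
        (𝓝 fun ξ => fderiv ℝ (fun γ => T γ ξ) γ v) := fun v =>
      tendsto_pi_nhds.2 fun ξ => by simpa using (h ξ γ hγ).hasFDerivAt.lim_real v
    let L : F →ₗ[ℝ] X →L[ℝ] Y :=
      { toFun := fun v => continuousLinearMapOfTendsto _ (hlim v)
        map_add' := fun v w => by
          ext ξ
          exact map_add (fderiv ℝ (fun γ => T γ ξ) γ) v w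
        map_smul' := fun c v => by
          ext ξ
          exact map_smul (fderiv ℝ (fun γ => T γ ξ) γ) c v }
    refine ⟨(LinearMap.toContinuousLinearMap L).flip, fun ξ => ?_⟩
    have e : (LinearMap.toContinuousLinearMap L).flip ξ = fderiv ℝ (fun γ => T γ ξ) γ := by
      ext v
      rfl
    exact e ▸ (h ξ γ hγ).hasFDerivAt
  choose! T' hT' using key
  exact ⟨T', hT'⟩

/-- The mean value inequality for families of operators: a strong derivative that is continuous in
operator norm is a derivative in operator norm. -/
theorem norm_sub_sub_le_of_hasFDerivAt_apply {T : F → X →L[ℝ] Y} {T' : F → X →L[ℝ] F →L[ℝ] Y}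
    {s : Set F} (hs : Convex ℝ s) (h : ∀ γ ∈ s, ∀ ξ, HasFDerivAt (fun γ => T γ ξ) (T' γ ξ) γ)
    {A : X →L[ℝ] F →L[ℝ] Y} {C : ℝ} (hC0 : 0 ≤ C) (hC : ∀ γ ∈ s, ‖T' γ - A‖ ≤ C)
    {γ γ' : F} (hγ : γ ∈ s) (hγ' : γ' ∈ s) :
    ‖T γ' - T γ - A.flip (γ' - γ)‖ ≤ C * ‖γ' - γ‖ := by
  refine ContinuousLinearMap.opNorm_le_bound _ (by positivity) fun ξ => ?_
  have := hs.norm_image_sub_le_of_norm_hasFDerivWithin_le'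
    (fun x hx => (h x hx ξ).hasFDerivWithinAt) (φ := A ξ) (C := C * ‖ξ‖) (fun x hx => ?_) hγ hγ'
  · simpa [mul_right_comm] using this
  · exact ((T' x - A).le_opNorm ξ).trans (by gcongr; exact hC x hx)

theorem continuousOn_of_apply_contDiffOn_one [FiniteDimensional ℝ F] [CompleteSpace X]
    {T : F → X →L[ℝ] Y} {G : Set F} (hG : IsOpen G)
    (h : ∀ ξ, ContDiffOn ℝ 1 (fun γ => T γ ξ) G) : ContinuousOn T G := by
  obtain ⟨T', hT'⟩ := exists_family_hasFDerivAt_apply fun ξ γ hγ =>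
    ((h ξ).contDiffAt (hG.mem_nhds hγ)).differentiableAt one_ne_zero
  have hcont : ∀ ξ, ContinuousOn (fun γ => T' γ ξ) G := fun ξ =>
    ((h ξ).continuousOn_fderiv_of_isOpen hG le_rfl).congr fun γ hγ => (hT' γ hγ ξ).fderiv.symm
  intro γ hγ
  obtain ⟨r, hr, hrG⟩ := Metric.nhds_basis_closedBall.mem_iff.1 (hG.mem_nhds hγ)
  obtain ⟨C, hC0, hC⟩ := exists_forall_norm_le_of_continuousOn_apply
    (isCompact_closedBall γ r) fun ξ => (hcont ξ).mono hrG
  refine (LipschitzOnWith.continuousOn (K := C.toNNReal) (s := Metric.closedBall γ r) ?_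
    |>.continuousAt (Metric.closedBall_mem_nhds γ hr)).continuousWithinAt
  refine LipschitzOnWith.of_dist_le_mul fun x hx y hy => ?_
  have := norm_sub_sub_le_of_hasFDerivAt_apply (A := 0) (convex_closedBall γ r)
    (fun x hx => hT' x (hrG hx)) hC0 (by simpa using hC) hy hx
  simpa [dist_eq_norm, Real.coe_toNNReal C hC0] using this

/-- A family of operators that is strongly `C^(m+1)` is `C^m` in the operator norm. -/
theorem contDiffOn_of_apply_succ {F : Type} {X : Type*} [NormedAddCommGroup F] [NormedSpace ℝ F]
    [NormedAddCommGroup X] [NormedSpace ℝ X] [FiniteDimensional ℝ F] [CompleteSpace X]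
    {G : Set F} (hG : IsOpen G) (m : ℕ) : ∀ {Y : Type _} [NormedAddCommGroup Y] [NormedSpace ℝ Y]
    {T : F → X →L[ℝ] Y}, (∀ ξ, ContDiffOn ℝ (m + 1 : ℕ) (fun γ => T γ ξ) G) →
      ContDiffOn ℝ m T G := by
  induction m with
  | zero =>
    intro Y _ _ T h
    simpa using continuousOn_of_apply_contDiffOn_one hG (by simpa using h)
  | succ m ih =>
    intro Y _ _ T h
    obtain ⟨T', hT'⟩ := exists_family_hasFDerivAt_apply fun ξ γ hγ =>
      ((h ξ).contDiffAt (hG.mem_nhds hγ)).differentiableAt (by simp)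
    have hsmooth : ∀ ξ, ContDiffOn ℝ (m + 1 : ℕ) (fun γ => T' γ ξ) G := fun ξ => by
      have h1 := h ξ
      rw [Nat.cast_succ (m + 1)] at h1
      exact (((contDiffOn_succ_iff_fderiv_of_isOpen hG).1 h1).2.2).congr
        fun γ hγ => (hT' γ hγ ξ).fderiv.symm
    have hnorm : ContDiffOn ℝ m T' G := ih hsmooth
    have hflip : ContDiff ℝ m (fun A : X →L[ℝ] F →L[ℝ] Y => A.flip) :=
      IsBoundedLinearMap.contDiff ⟨⟨fun _ _ => rfl, fun _ _ => rfl⟩, 1, one_pos, fun A => by simp⟩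
    refine contDiffOn_succ_of_hasFDerivAt hG (f' := fun γ => (T' γ).flip) (fun γ hγ => ?_)
      (hflip.comp_contDiffOn hnorm)
    refine HasFDerivAt.of_isLittleO (Asymptotics.isLittleO_iff.2 fun c hc => ?_)
    have hnear : ∀ᶠ x in 𝓝 γ, x ∈ G ∧ ‖T' x - T' γ‖ ≤ c := by
      refine (hG.eventually_mem hγ).and ?_
      have := Metric.tendsto_nhds.1 (hnorm.continuousOn.continuousAt (hG.mem_nhds hγ)) c hc
      filter_upwards [this] with x hx
      exact (dist_eq_norm (T' x) (T' γ) ▸ hx).le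
    obtain ⟨r, hr, hrG⟩ := Metric.nhds_basis_ball.mem_iff.1 hnear
    filter_upwards [Metric.ball_mem_nhds γ hr] with x hx
    exact norm_sub_sub_le_of_hasFDerivAt_apply (convex_ball γ r) (fun y hy => hT' y (hrG hy).1)
      hc.le (fun y hy => (hrG hy).2) (Metric.mem_ball_self hr) hx

/-- A family of operators that is strongly `C^m` is jointly `C^m` in the parameter and the
argument. -/
theorem contDiffOn_prod_apply {F : Type} {X : Type*} [NormedAddCommGroup F] [NormedSpace ℝ F]
    [NormedAddCommGroup X] [NormedSpace ℝ X] [FiniteDimensional ℝ F] [CompleteSpace X]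
    {G : Set F} (hG : IsOpen G) (m : ℕ) : ∀ {Y : Type _} [NormedAddCommGroup Y] [NormedSpace ℝ Y]
    {T : F → X →L[ℝ] Y}, (∀ ξ, ContDiffOn ℝ m (fun γ => T γ ξ) G) →
      ContDiffOn ℝ m (fun z : F × X => T z.1 z.2) (G ×ˢ univ) := by
  induction m with
  | zero =>
    intro Y _ _ T h
    simpa using continuousOn_prod_apply hG (by simpa using h)
  | succ m ih =>
    intro Y _ _ T h
    obtain ⟨T', hT'⟩ := exists_family_hasFDerivAt_apply fun ξ γ hγ =>
      ((h ξ).contDiffAt (hG.mem_nhds hγ)).differentiableAt (by simp)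
    have hsmooth : ∀ ξ, ContDiffOn ℝ m (fun γ => T' γ ξ) G := fun ξ => by
      have h1 := h ξ
      rw [Nat.cast_succ m] at h1
      exact (((contDiffOn_succ_iff_fderiv_of_isOpen hG).1 h1).2.2).congr
        fun γ hγ => (hT' γ hγ ξ).fderiv.symm
    have hnorm : ContDiffOn ℝ m T G := contDiffOn_of_apply_succ hG m h
    have hjoint : ContDiffOn ℝ m (fun z : F × X => T' z.1 z.2) (G ×ˢ univ) := ih hsmooth
    refine contDiffOn_succ_of_hasFDerivAt (hG.prod isOpen_univ)
      (f' := fun z => (T z.1).comp (ContinuousLinearMap.snd ℝ F X) +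
        (T' z.1 z.2).comp (ContinuousLinearMap.fst ℝ F X)) ?_ ?_
    -- near `(γ, ξ)` write `T z.1 z.2 = (T z.1 - T γ) (z.2 - ξ) + T γ (z.2 - ξ) + T z.1 ξ`; the
    -- first term is of second order because `T` is continuous in the operator norm
    · rintro ⟨γ, ξ⟩ ⟨hγ, -⟩
      have h1 : HasFDerivAt (fun z : F × X => T z.1 ξ)
          ((T' γ ξ).comp (ContinuousLinearMap.fst ℝ F X)) (γ, ξ) :=
        HasFDerivAt.comp (g := fun γ => T γ ξ) (γ, ξ) (hT' γ hγ ξ) hasFDerivAt_fst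
      have h2 : HasFDerivAt (fun z : F × X => T γ (z.2 - ξ))
          ((T γ).comp (ContinuousLinearMap.snd ℝ F X)) (γ, ξ) :=
        (T γ).hasFDerivAt.comp (γ, ξ) (hasFDerivAt_snd.sub_const ξ)
      have h3 : HasFDerivAt (fun z : F × X => (T z.1 - T γ) (z.2 - ξ))
          (0 : F × X →L[ℝ] Y) (γ, ξ) := by
        refine HasFDerivAt.of_isLittleO (Asymptotics.isLittleO_iff.2 fun c hc => ?_)
        have hc1 : ContinuousAt (fun z : F × X => T z.1) (γ, ξ) :=
          ContinuousAt.comp (f := Prod.fst) (g := T)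
            (hnorm.continuousOn.continuousAt (hG.mem_nhds hγ)) continuousAt_fst
        filter_upwards [Metric.tendsto_nhds.1 hc1 c hc] with z hz
        have hz' : ‖T z.1 - T γ‖ ≤ c := (dist_eq_norm (T z.1) (T γ) ▸ hz).le
        have hz2 : ‖z.2 - ξ‖ ≤ ‖z - (γ, ξ)‖ := norm_snd_le (z - (γ, ξ))
        simpa using ((T z.1 - T γ).le_opNorm (z.2 - ξ)).trans
          (mul_le_mul hz' hz2 (norm_nonneg _) hc.le)
      have h4 := (h3.add h2).add h1
      rw [zero_add] at h4
      refine h4.congr_of_eventuallyEq (.of_forall fun z => ?_)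
      simp
    · exact (((ContinuousLinearMap.compL ℝ (F × X) X Y).flip
          (ContinuousLinearMap.snd ℝ F X)).contDiff.comp_contDiffOn
          (hnorm.comp contDiff_fst.contDiffOn fun z hz => hz.1)).add
        (((ContinuousLinearMap.compL ℝ (F × X) F Y).flip
          (ContinuousLinearMap.fst ℝ F X)).contDiff.comp_contDiffOn hjoint)

/-- A map into a complete space is `C^m` if its composition with a linear isometry is: the
isometry has closed range, so that the derivatives of the composition stay in the range. -/
theorem contDiffOn_of_linearIsometry_comp {F : Type} [NormedAddCommGroup F] [NormedSpace ℝ F]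
    {G : Set F} (hG : IsOpen G) (m : ℕ) : ∀ {Y Z : Type _} [NormedAddCommGroup Y]
    [NormedSpace ℝ Y] [CompleteSpace Y] [NormedAddCommGroup Z] [NormedSpace ℝ Z]
    (J : Y →ₗᵢ[ℝ] Z) {f : F → Y}, ContDiffOn ℝ m (fun γ => J (f γ)) G → ContDiffOn ℝ m f G := by
  induction m with
  | zero =>
    intro Y Z _ _ _ _ _ J f h
    have h1 : ContinuousOn (fun γ => J (f γ)) G := by simpa using h
    simpa using J.isometry.isEmbedding.continuousOn_iff.2 h1
  | succ m ih =>
    intro Y Z _ _ _ _ _ J f h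
    have hd : ∀ γ ∈ G, HasFDerivAt (fun γ => J (f γ)) (fderiv ℝ (fun γ => J (f γ)) γ) γ :=
      fun γ hγ => ((h.contDiffAt (hG.mem_nhds hγ)).differentiableAt (by simp)).hasFDerivAt
    have hclosed : IsClosed (range J) := J.isometry.isClosedEmbedding.isClosed_range
    have key : ∀ γ ∈ G, ∃ A : F →L[ℝ] Y,
        J.toContinuousLinearMap.comp A = fderiv ℝ (fun γ => J (f γ)) γ := by
      intro γ hγ
      have hmem : ∀ v, fderiv ℝ (fun γ => J (f γ)) γ v ∈ range J := fun v =>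
        hclosed.mem_of_tendsto ((hd γ hγ).lim_real v) (.of_forall fun c =>
          ⟨c • (f (γ + c⁻¹ • v) - f γ), by simp⟩)
      choose A hA using hmem
      refine ⟨LinearMap.mkContinuous ⟨⟨A, fun v w => J.injective ?_⟩, fun c v => J.injective ?_⟩
        ‖fderiv ℝ (fun γ => J (f γ)) γ‖ fun v => ?_, ?_⟩
      · rw [map_add, hA, hA, hA, map_add]
      · rw [map_smul, hA, hA, map_smul]; rfl
      · have := (fderiv ℝ (fun γ => J (f γ)) γ).le_opNorm v
        rwa [← hA, J.norm_map] at this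
      · ext v
        exact hA v
    choose! A hA using key
    let J' : (F →L[ℝ] Y) →ₗᵢ[ℝ] (F →L[ℝ] Z) :=
      { toLinearMap := (ContinuousLinearMap.compL ℝ F Y Z J.toContinuousLinearMap).toLinearMap
        norm_map' := fun B => J.norm_toContinuousLinearMap_comp }
    refine contDiffOn_succ_of_hasFDerivAt hG (f' := A) (fun γ hγ => ?_) (ih J' ?_)
    · have h1 := hd γ hγ
      refine HasFDerivAt.of_isLittleO (Asymptotics.IsBigO.trans_isLittleO ?_ h1.isLittleO)
      refine Asymptotics.IsBigO.of_bound 1 (.of_forall fun x => ?_)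
      rw [one_mul, ← hA γ hγ]
      refine le_of_eq ?_
      rw [← J.norm_map, map_sub, map_sub]
      rfl
    · rw [Nat.cast_succ m] at h
      exact (((contDiffOn_succ_iff_fderiv_of_isOpen hG).1 h).2.2).congr fun γ hγ => hA γ hγ

end StrongFamilies

/-! ### Mollification -/

section Mollification

variable {E : Type*} [NormedAddCommGroup E] [NormedSpace ℝ E]

/-- `g` is the weak partial derivative of order one of `u` in the `q`-th coordinate direction. -/
def HasWeakDeriv (q : Fin 2) (u g : Plane → E) : Prop :=
  ∀ θ : Plane → ℝ, ContDiff ℝ ∞ θ → HasCompactSupport θ →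
    ∫ x, (fderiv ℝ θ x (EuclideanSpace.single q 1)) • u x = -∫ x, θ x • g x

theorem tendsto_eLpNorm_translate_sub {p : ℝ≥0∞} [Fact (1 ≤ p)] (hp : p ≠ ⊤)
    (f : Lp E p (volume : Measure Plane)) :
    Tendsto (fun t : Plane => eLpNorm (fun x => f (x - t) - f x) p volume) (𝓝 0) (𝓝 0) := by
  let τ : C(Plane, C(Plane, Plane)) :=
    ContinuousMap.curry ⟨fun z : Plane × Plane => z.2 - z.1, by fun_prop⟩
  have hτ : ∀ t, MeasurePreserving (τ t) volume volume := fun t => measurePreserving_sub_right _ t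
  have h1 : Continuous fun t => Lp.compMeasurePreserving (τ t) (hτ t) f :=
    continuous_const.compMeasurePreservingLp τ.continuous hτ hp
  have h2 := tendsto_iff_edist_tendsto_0.1 (h1.tendsto 0)
  refine h2.congr fun t => ?_
  rw [Lp.edist_def]
  refine eLpNorm_congr_ae ?_
  filter_upwards [Lp.coeFn_compMeasurePreserving f (hτ t),
    Lp.coeFn_compMeasurePreserving f (hτ 0)] with x hx hx0
  simp only [Pi.sub_apply, hx, hx0]
  simp [τ]

variable [CompleteSpace E]

/-- By Jensen's inequality and Tonelli's theorem, a mollification is as close to `f` as the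
translates of `f` by vectors in the support of the mollifier. -/
theorem eLpNorm_convolution_sub_le {p : ℝ≥0∞} [hp1 : Fact (1 ≤ p)] (hp : p ≠ ⊤) {η : Plane → ℝ}
    (hη : Continuous η) (hc : HasCompactSupport η) (h0 : ∀ x, 0 ≤ η x) (h1 : ∫ x, η x = 1)
    (f : Lp E p (volume : Measure Plane)) {δ : ℝ≥0∞}
    (hδ : ∀ t, η t ≠ 0 → eLpNorm (fun x => f (x - t) - f x) p volume ≤ δ) :
    eLpNorm (η ⋆[ContinuousLinearMap.lsmul ℝ ℝ, volume] (f : Plane → E) - (f : Plane → E)) p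
      volume ≤ δ := by
  have hint : Integrable η := hη.integrable_of_hasCompactSupport hc
  set ν : Measure Plane := volume.withDensity fun t => ENNReal.ofReal (η t) with hν
  have hηm : Measurable fun t => ENNReal.ofReal (η t) := hη.measurable.ennreal_ofReal
  have hprob : IsProbabilityMeasure ν := ⟨by
    rw [hν, withDensity_apply _ MeasurableSet.univ, Measure.restrict_univ,
      ← ofReal_integral_eq_lintegral_ofReal hint (.of_forall h0), h1, ENNReal.ofReal_one]⟩
  have hp0 : p ≠ 0 := (one_pos.trans_le hp1.out).ne'
  have hpr : 0 < p.toReal := ENNReal.toReal_pos hp0 hp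
  have hfm := Lp.stronglyMeasurable f
  have hm : StronglyMeasurable fun z : Plane × Plane => f (z.1 - z.2) - f z.1 :=
    (hfm.comp_measurable (measurable_fst.sub measurable_snd)).sub
      (hfm.comp_measurable measurable_fst)
  -- Jensen's inequality for the probability measure `ν = η dt`
  have hpt : ∀ x, ‖(η ⋆[ContinuousLinearMap.lsmul ℝ ℝ, volume] (f : Plane → E) -
      (f : Plane → E)) x‖ₑ ^ p.toReal ≤ ∫⁻ t, ‖f (x - t) - f x‖ₑ ^ p.toReal ∂ν := by
    intro x
    have hloc : LocallyIntegrable (f : Plane → E) volume := (Lp.memLp f).locallyIntegrable hp1.out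
    have hi : Integrable (fun t => η t • f (x - t)) volume :=
      hc.convolutionExists_left (ContinuousLinearMap.lsmul ℝ ℝ) hη hloc x
    have e : (η ⋆[ContinuousLinearMap.lsmul ℝ ℝ, volume] (f : Plane → E) - (f : Plane → E)) x =
        ∫ t, η t • (f (x - t) - f x) := by
      simp only [Pi.sub_apply, convolution_lsmul, smul_sub]
      rw [integral_sub hi (hint.smul_const _), integral_smul_const, h1, one_smul]
    have hmx : AEStronglyMeasurable (fun t => f (x - t) - f x) ν :=
      (hm.comp_measurable measurable_prodMk_left).aestronglyMeasurable
    have hle : ‖(η ⋆[ContinuousLinearMap.lsmul ℝ ℝ, volume] (f : Plane → E) -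
        (f : Plane → E)) x‖ₑ ≤ eLpNorm (fun t => f (x - t) - f x) 1 ν := by
      rw [e, eLpNorm_one_eq_lintegral_enorm, hν,
        lintegral_withDensity_eq_lintegral_mul₀ hηm.aemeasurable]
      · refine (enorm_integral_le_lintegral_enorm _).trans (lintegral_mono fun t => ?_)
        simp only [Pi.mul_apply, enorm_smul]
        rw [Real.enorm_of_nonneg (h0 t)]
      · exact (hm.comp_measurable measurable_prodMk_left).aestronglyMeasurable.enorm
    have hle2 := hle.trans (eLpNorm_le_eLpNorm_of_exponent_le hp1.out hmx)
    rw [eLpNorm_eq_lintegral_rpow_enorm_toReal hp0 hp] at hle2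
    calc _ ≤ _ := ENNReal.rpow_le_rpow hle2 hpr.le
      _ = _ := by rw [← ENNReal.rpow_mul, one_div_mul_cancel hpr.ne', ENNReal.rpow_one]
  rw [eLpNorm_eq_lintegral_rpow_enorm_toReal hp0 hp]
  have hmm : Measurable fun z : Plane × Plane => ‖f (z.1 - z.2) - f z.1‖ₑ ^ p.toReal :=
    hm.enorm.pow_const _
  have hfin : ∫⁻ x, ‖(η ⋆[ContinuousLinearMap.lsmul ℝ ℝ, volume] (f : Plane → E) -
      (f : Plane → E)) x‖ₑ ^ p.toReal ≤ δ ^ p.toReal := by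
    calc _ ≤ ∫⁻ x, ∫⁻ t, ‖f (x - t) - f x‖ₑ ^ p.toReal ∂ν := lintegral_mono hpt
      _ = ∫⁻ t, (∫⁻ x, ‖f (x - t) - f x‖ₑ ^ p.toReal) ∂ν :=
        lintegral_lintegral_swap hmm.aemeasurable
      _ = ∫⁻ t, ENNReal.ofReal (η t) * ∫⁻ x, ‖f (x - t) - f x‖ₑ ^ p.toReal := by
        rw [hν, lintegral_withDensity_eq_lintegral_mul₀ hηm.aemeasurable]
        · rfl
        · exact (hmm.lintegral_prod_left').aemeasurable
      _ ≤ ∫⁻ t, ENNReal.ofReal (η t) * δ ^ p.toReal := by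
        refine lintegral_mono fun t => ?_
        by_cases ht : η t = 0
        · simp [ht]
        · have := hδ t ht
          rw [eLpNorm_eq_lintegral_rpow_enorm_toReal hp0 hp] at this
          have h2 := ENNReal.rpow_le_rpow this hpr.le
          rw [← ENNReal.rpow_mul, one_div_mul_cancel hpr.ne', ENNReal.rpow_one] at h2
          dsimp only
          gcongr
      _ = δ ^ p.toReal := by
        rw [lintegral_mul_const _ hηm, ← ofReal_integral_eq_lintegral_ofReal hint (.of_forall h0),
          h1, ENNReal.ofReal_one, one_mul]
  calc _ ≤ (δ ^ p.toReal) ^ (1 / p.toReal) := ENNReal.rpow_le_rpow hfin (by positivity)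
    _ = δ := by rw [← ENNReal.rpow_mul, mul_one_div_cancel hpr.ne', ENNReal.rpow_one]

/-- Bump functions on the plane with supports shrinking to the origin. -/
noncomputable def shrinkingBump (n : ℕ) : ContDiffBump (0 : Plane) where
  rIn := 1 / (n + 2)
  rOut := 1 / (n + 1)
  rIn_pos := by positivity
  rIn_lt_rOut := by gcongr; norm_num

theorem tendsto_eLpNorm_convolution_sub {p : ℝ≥0∞} [hp1 : Fact (1 ≤ p)] (hp : p ≠ ⊤)
    {f : Plane → E} (hf : MemLp f p volume) :
    Tendsto (fun n => eLpNorm ((shrinkingBump n).normed volume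
      ⋆[ContinuousLinearMap.lsmul ℝ ℝ, volume] f - f) p volume) atTop (𝓝 0) := by
  have e : ∀ n, eLpNorm ((shrinkingBump n).normed volume
      ⋆[ContinuousLinearMap.lsmul ℝ ℝ, volume] f - f) p volume = eLpNorm
      ((shrinkingBump n).normed volume
      ⋆[ContinuousLinearMap.lsmul ℝ ℝ, volume] (hf.toLp f : Plane → E) -
        (hf.toLp f : Plane → E)) p volume := fun n => by
    rw [convolution_congr _ (ae_eq_refl _) hf.coeFn_toLp]
    exact eLpNorm_congr_ae (hf.coeFn_toLp.mono fun x hx => by simp [hx])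
  simp_rw [e]
  refine ENNReal.tendsto_nhds_zero.2 fun δ hδ => ?_
  obtain ⟨r, hr, hrδ⟩ := Metric.nhds_basis_ball.mem_iff.1
    (ENNReal.tendsto_nhds_zero.1 (tendsto_eLpNorm_translate_sub hp (hf.toLp f)) δ hδ)
  filter_upwards [tendsto_one_div_add_atTop_nhds_zero_nat.eventually (gt_mem_nhds hr)] with n hn
  refine eLpNorm_convolution_sub_le hp (shrinkingBump n).continuous_normed
    (shrinkingBump n).hasCompactSupport_normed (shrinkingBump n).nonneg_normed
    (shrinkingBump n).integral_normed _ fun t ht => ?_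
  have h1 : t ∈ Function.support ((shrinkingBump n).normed volume) := ht
  rw [(shrinkingBump n).support_normed_eq] at h1
  exact hrδ (Metric.ball_subset_ball hn.le h1)

/-- The derivative of a mollification is the mollification of the weak derivative. -/
theorem HasWeakDeriv.fderiv_convolution {q : Fin 2} {u g : Plane → E} (h : HasWeakDeriv q u g)
    (hu : LocallyIntegrable u volume) {η : Plane → ℝ} (hη : ContDiff ℝ ∞ η)
    (hc : HasCompactSupport η) (x : Plane) :
    fderiv ℝ (η ⋆[ContinuousLinearMap.lsmul ℝ ℝ, volume] u) x (EuclideanSpace.single q 1) =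
      (η ⋆[ContinuousLinearMap.lsmul ℝ ℝ, volume] g) x := by
  have hη1 : ContDiff ℝ 1 η := hη.of_le (by exact_mod_cast le_top)
  rw [(hc.hasFDerivAt_convolution_left _ hη1 hu x).fderiv, convolution_eq_swap,
    ContinuousLinearMap.integral_apply, convolution_lsmul_swap]
  · have hθ : ContDiff ℝ ∞ fun t => η (x - t) := hη.comp (contDiff_const.sub contDiff_id)
    have hθc : HasCompactSupport fun t => η (x - t) :=
      hc.comp_homeomorph (Homeomorph.subLeft x)
    have := h _ hθ hθc
    rw [eq_neg_iff_add_eq_zero, add_comm, ← eq_neg_iff_add_eq_zero, ← integral_neg] at this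
    rw [this]
    refine integral_congr_ae (.of_forall fun t => ?_)
    have e : fderiv ℝ (fun t => η (x - t)) t (EuclideanSpace.single q 1) =
        -fderiv ℝ η (x - t) (EuclideanSpace.single q 1) := by
      have h1 : HasFDerivAt (fun t => η (x - t))
          ((fderiv ℝ η (x - t)).comp (-ContinuousLinearMap.id ℝ Plane)) t :=
        ((hη1.differentiable one_ne_zero) (x - t)).hasFDerivAt.comp t
          ((hasFDerivAt_id t).const_sub x)
      rw [h1.fderiv]
      simp
    simp only [e, neg_smul, neg_neg]
    rfl
  · have := (hc.fderiv ℝ).convolutionExists_left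
      ((ContinuousLinearMap.lsmul ℝ ℝ : ℝ →L[ℝ] E →L[ℝ] E).precompL Plane)
      (hη1.continuous_fderiv one_ne_zero) hu x
    exact this.integrable_swap

/-- A function in `W^{1,p}` is a limit in `W^{1,p}` of smooth functions. -/
theorem exists_contDiff_tendsto {p : ℝ≥0∞} [hp1 : Fact (1 ≤ p)] (hp : p ≠ ⊤)
    {u : Plane → E} (hu : MemLp u p volume) {g : Fin 2 → Plane → E}
    (hg : ∀ q, MemLp (g q) p volume) (h : ∀ q, HasWeakDeriv q u (g q)) :
    ∃ v : ℕ → Plane → E, (∀ n, ContDiff ℝ ∞ (v n)) ∧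
      Tendsto (fun n => eLpNorm (v n - u) p volume) atTop (𝓝 0) ∧
      ∀ q, Tendsto (fun n => eLpNorm
        ((fun x => fderiv ℝ (v n) x (EuclideanSpace.single q 1)) - g q) p volume)
        atTop (𝓝 0) := by
  have hloc := hu.locallyIntegrable hp1.out
  refine ⟨fun n => (shrinkingBump n).normed volume ⋆[ContinuousLinearMap.lsmul ℝ ℝ, volume] u,
    fun n => (shrinkingBump n).hasCompactSupport_normed.contDiff_convolution_left _
      (shrinkingBump n).contDiff_normed hloc, tendsto_eLpNorm_convolution_sub hp hu, fun q => ?_⟩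
  refine (tendsto_eLpNorm_convolution_sub hp (hg q)).congr fun n => ?_
  congr 2
  funext x
  exact ((h q).fderiv_convolution hloc (shrinkingBump n).contDiff_normed
    (shrinkingBump n).hasCompactSupport_normed x).symm

end Mollification

/-! ### Weighted composition operators on the plane -/

section PlaneOperators

/-- A smooth family `ψ (γ, ·)`, `γ ∈ G`, of injective local diffeomorphisms between open parts of
the plane. The domain of `ψ (γ, ·)` is the slice of `Ω` over `γ`. The set `S`, closed relative to
`G × ℝ²`, confines the supports of the weights used with the family: its slices lie in the fixed
compact set `L`. -/
structure PlaneFamily (n : ℕ) where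
  /-- the parameter domain -/
  G : Set (EuclideanSpace ℝ (Fin n))
  isOpen_G : IsOpen G
  /-- the family of maps -/
  ψ : EuclideanSpace ℝ (Fin n) × Plane → Plane
  /-- the domain of the family -/
  Ω : Set (EuclideanSpace ℝ (Fin n) × Plane)
  isOpen_Ω : IsOpen Ω
  contDiffOn_ψ : ContDiffOn ℝ ∞ ψ Ω
  injOn_ψ : ∀ γ, InjOn (fun x => ψ (γ, x)) {x | (γ, x) ∈ Ω}
  det_ne_zero : ∀ z ∈ Ω,
    ((fderiv ℝ ψ z).comp (ContinuousLinearMap.inr ℝ (EuclideanSpace ℝ (Fin n)) Plane)).det ≠ 0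
  /-- the set outside which all weights vanish -/
  S : Set (EuclideanSpace ℝ (Fin n) × Plane)
  S_subset : S ⊆ Ω
  isOpen_diff : IsOpen ((G ×ˢ univ) \ S)
  /-- a compact set which contains the supports of all weights -/
  L : Set Plane
  isCompact_L : IsCompact L
  snd_mem_L : ∀ z ∈ S, z.2 ∈ L

namespace PlaneFamily

variable {n : ℕ} (A : PlaneFamily n) {E : Type*} [NormedAddCommGroup E] [NormedSpace ℝ E]

/-- A weight for the family: a smooth function on `G × ℝ²` that vanishes outside `S`. -/
structure IsWeight (b : EuclideanSpace ℝ (Fin n) × Plane → ℝ) : Prop where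
  contDiffOn : ContDiffOn ℝ ∞ b (A.G ×ˢ univ)
  eq_zero : ∀ z ∈ A.G ×ˢ univ, z ∉ A.S → b z = 0

/-- The weighted composition `x ↦ b (γ, x) • u (ψ (γ, x))`. -/
def pull (b : EuclideanSpace ℝ (Fin n) × Plane → ℝ) (u : Plane → E)
    (γ : EuclideanSpace ℝ (Fin n)) (x : Plane) : E :=
  b (γ, x) • u (A.ψ (γ, x))

theorem isOpen_prod : IsOpen (A.G ×ˢ (univ : Set Plane)) := A.isOpen_G.prod isOpen_univ

variable {A}

theorem isClosed_slice {γ : EuclideanSpace ℝ (Fin n)} (hγ : γ ∈ A.G) :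
    IsClosed {x | (γ, x) ∈ A.S} := by
  have h : IsOpen ((fun x : Plane => (γ, x)) ⁻¹' ((A.G ×ˢ univ) \ A.S)) :=
    A.isOpen_diff.preimage (by fun_prop)
  rw [← isOpen_compl_iff]
  convert h using 1
  ext x
  simp [hγ]

theorem exists_isCompact_box {γ₀ : EuclideanSpace ℝ (Fin n)} (h : γ₀ ∈ A.G) :
    ∃ U ∈ 𝓝 γ₀, U ⊆ A.G ∧ IsCompact {z | z ∈ A.S ∧ z.1 ∈ U} := by
  obtain ⟨r, hr, hrG⟩ := Metric.nhds_basis_closedBall.mem_iff.1 (A.isOpen_G.mem_nhds h)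
  refine ⟨_, Metric.closedBall_mem_nhds γ₀ hr, hrG, ?_⟩
  have hK := ((isCompact_closedBall γ₀ r).prod A.isCompact_L).diff A.isOpen_diff
  convert hK using 1
  ext z
  simp only [mem_ofPred_eq, Set.mem_sdiff, mem_prod, mem_univ, and_true, not_and, not_not]
  exact ⟨fun hz => ⟨⟨hz.2, A.snd_mem_L z hz.1⟩, fun _ => hz.1⟩,
    fun hz => ⟨hz.2 (hrG hz.1.1), hz.1.1⟩⟩

theorem hasFDerivAt_slice {z : EuclideanSpace ℝ (Fin n) × Plane} (hz : z ∈ A.Ω) :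
    HasFDerivAt (fun x => A.ψ (z.1, x)) ((fderiv ℝ A.ψ z).comp
      (ContinuousLinearMap.inr ℝ (EuclideanSpace ℝ (Fin n)) Plane)) z.2 := by
  have h : HasFDerivAt A.ψ (fderiv ℝ A.ψ z) z :=
    ((A.contDiffOn_ψ.contDiffAt (A.isOpen_Ω.mem_nhds hz)).differentiableAt
      (by simp)).hasFDerivAt
  exact HasFDerivAt.comp (f := fun x => (z.1, x)) z.2 h (hasFDerivAt_prodMk_right z.1 z.2)

theorem aemeasurable_slice {γ : EuclideanSpace ℝ (Fin n)} (hγ : γ ∈ A.G) :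
    AEMeasurable (fun x => A.ψ (γ, x)) (volume.restrict {x | (γ, x) ∈ A.S}) := by
  refine ContinuousOn.aemeasurable (fun x hx => ?_) (isClosed_slice hγ).measurableSet
  exact (hasFDerivAt_slice (z := (γ, x)) (A.S_subset hx)).continuousAt.continuousWithinAt

/-- The change of variables formula bounds the image measures, locally uniformly in the
parameter. -/
theorem exists_map_le {γ₀ : EuclideanSpace ℝ (Fin n)} (h : γ₀ ∈ A.G) :
    ∃ U ∈ 𝓝 γ₀, U ⊆ A.G ∧ ∃ C : NNReal, ∀ γ ∈ U,
      (volume.restrict {x | (γ, x) ∈ A.S}).map (fun x => A.ψ (γ, x)) ≤ (C : ℝ≥0∞) • volume := by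
  obtain ⟨U, hU, hUG, hK⟩ := exists_isCompact_box h
  let J := fun z => |((fderiv ℝ A.ψ z).comp
    (ContinuousLinearMap.inr ℝ (EuclideanSpace ℝ (Fin n)) Plane)).det|
  have hJc : ContinuousOn (fun z => (J z)⁻¹) {z | z ∈ A.S ∧ z.1 ∈ U} := by
    have h1 : ContinuousOn (fderiv ℝ A.ψ) A.Ω :=
      A.contDiffOn_ψ.continuousOn_fderiv_of_isOpen A.isOpen_Ω (by simp)
    have h2 : Continuous fun B : EuclideanSpace ℝ (Fin n) × Plane →L[ℝ] Plane =>
        (B.comp (ContinuousLinearMap.inr ℝ (EuclideanSpace ℝ (Fin n)) Plane)).det :=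
      ContinuousLinearMap.continuous_det.comp (by fun_prop)
    exact ((h2.comp_continuousOn (h1.mono fun z hz => A.S_subset hz.1)).abs).inv₀
      fun z hz => abs_ne_zero.2 (A.det_ne_zero z (A.S_subset hz.1))
  obtain ⟨C, hC⟩ := hK.exists_bound_of_continuousOn hJc
  refine ⟨U, hU, hUG, C.toNNReal, fun γ hγ => Measure.le_iff.2 fun N hN => ?_⟩
  have hS := (isClosed_slice (A := A) (hUG hγ)).measurableSet
  have hcv := lintegral_image_eq_lintegral_abs_det_fderiv_mul volume hS
    (fun x hx => (hasFDerivAt_slice (z := (γ, x)) (A.S_subset hx)).hasFDerivWithinAt)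
    ((A.injOn_ψ γ).mono fun x hx => A.S_subset hx) (N.indicator 1)
  rw [← lintegral_indicator_one hN, lintegral_map' (by fun_prop (disch := measurability))
    (aemeasurable_slice (hUG hγ))]
  calc ∫⁻ x in {x | (γ, x) ∈ A.S}, N.indicator 1 (A.ψ (γ, x))
      ≤ ∫⁻ x in {x | (γ, x) ∈ A.S}, (C.toNNReal : ℝ≥0∞) *
          (ENNReal.ofReal (J (γ, x)) * N.indicator 1 (A.ψ (γ, x))) := by
        refine setLIntegral_mono' hS fun x hx => ?_
        rw [← mul_assoc]
        refine le_mul_of_one_le_left zero_le ?_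
        have hpos : 0 < J (γ, x) := abs_pos.2 (A.det_ne_zero _ (A.S_subset hx))
        have h1 := hC (γ, x) ⟨hx, hγ⟩
        rw [Real.norm_of_nonneg (by positivity)] at h1
        have h2 : 1 ≤ C * J (γ, x) := by
          rwa [inv_le_iff_one_le_mul₀ hpos] at h1
        have hC0 : 0 ≤ C := (by positivity : (0 : ℝ) ≤ (J (γ, x))⁻¹).trans h1
        change 1 ≤ ENNReal.ofReal C * _
        rw [← ENNReal.ofReal_mul hC0, ← ENNReal.ofReal_one]
        exact ENNReal.ofReal_le_ofReal h2
    _ = C.toNNReal * ∫⁻ x in {x | (γ, x) ∈ A.S},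
          (ENNReal.ofReal (J (γ, x)) * N.indicator 1 (A.ψ (γ, x))) := by
        rw [lintegral_const_mul' _ _ ENNReal.coe_ne_top]
    _ ≤ C.toNNReal * ∫⁻ x, N.indicator 1 x :=
        mul_le_mul_right (hcv.symm.le.trans (setLIntegral_le_lintegral _ _)) _
    _ = ((C.toNNReal : ℝ≥0∞) • volume) N := by
        rw [lintegral_indicator_one hN]; rfl

theorem IsWeight.pull_eq_indicator {b : EuclideanSpace ℝ (Fin n) × Plane → ℝ} (hb : A.IsWeight b)
    {γ : EuclideanSpace ℝ (Fin n)} (hγ : γ ∈ A.G) (u : Plane → E) :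
    A.pull b u γ = {x | (γ, x) ∈ A.S}.indicator (A.pull b u γ) := by
  refine (indicator_eq_self.2 fun x hx => ?_).symm
  by_contra hS
  exact hx (by simp [pull, hb.eq_zero (γ, x) ⟨hγ, mem_univ _⟩ hS])

/-- The operators are well defined on a.e.-classes. -/
theorem IsWeight.pull_congr {b : EuclideanSpace ℝ (Fin n) × Plane → ℝ} (hb : A.IsWeight b)
    {γ : EuclideanSpace ℝ (Fin n)} (hγ : γ ∈ A.G) {u v : Plane → E} (h : u =ᵐ[volume] v) :
    A.pull b u γ =ᵐ[volume] A.pull b v γ := by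
  obtain ⟨U, hU, -, C, hC⟩ := exists_map_le hγ
  have h1 : u =ᵐ[(volume.restrict {x | (γ, x) ∈ A.S}).map (fun x => A.ψ (γ, x))] v :=
    (Measure.absolutelyContinuous_of_le_smul (hC γ (mem_of_mem_nhds hU))).ae_le h
  filter_upwards [(ae_restrict_iff' (isClosed_slice hγ).measurableSet).1
    (ae_of_ae_map (aemeasurable_slice hγ) h1)] with x hx
  by_cases hS : (γ, x) ∈ A.S
  · simp only [pull, hx hS]
  · simp [pull, hb.eq_zero (γ, x) ⟨hγ, mem_univ _⟩ hS]

/-- The operators are bounded on `L^p`, locally uniformly in the parameter. -/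
theorem IsWeight.exists_eLpNorm_pull_le {b : EuclideanSpace ℝ (Fin n) × Plane → ℝ}
    (hb : A.IsWeight b) {p : ℝ≥0∞} (hp : p ≠ ⊤) {γ₀ : EuclideanSpace ℝ (Fin n)} (h : γ₀ ∈ A.G) :
    ∃ U ∈ 𝓝 γ₀, U ⊆ A.G ∧ ∃ C : NNReal, ∀ γ ∈ U, ∀ u : Plane → E, MemLp u p volume →
      MemLp (A.pull b u γ) p volume ∧
        eLpNorm (A.pull b u γ) p volume ≤ C * eLpNorm u p volume := by
  obtain ⟨U, hU, hUG, C, hC⟩ := exists_map_le h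
  obtain ⟨V, hV, hVG, hK⟩ := exists_isCompact_box h
  obtain ⟨B, hB⟩ := hK.exists_bound_of_continuousOn
    (hb.contDiffOn.continuousOn.mono fun z hz => ⟨hVG hz.2, mem_univ _⟩)
  refine ⟨U ∩ V, inter_mem hU hV, inter_subset_left.trans hUG,
    B.toNNReal * C ^ (1 / p).toReal, fun γ hγ u hu => ?_⟩
  have hS := (isClosed_slice (A := A) (hUG hγ.1)).measurableSet
  have hψ := aemeasurable_slice (A := A) (hUG hγ.1)
  have hu' := (hu.smul_measure (c := C) ENNReal.coe_ne_top).mono_measure (hC γ hγ.1)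
  have hcomp : MemLp (fun x => u (A.ψ (γ, x))) p (volume.restrict {x | (γ, x) ∈ A.S}) :=
    hu'.comp_of_map hψ
  have hbc : Continuous fun x => b (γ, x) :=
    hb.contDiffOn.continuousOn.comp_continuous (by fun_prop) fun x => ⟨hUG hγ.1, mem_univ _⟩
  have hle : ∀ᵐ x ∂(volume.restrict {x | (γ, x) ∈ A.S}),
      ‖A.pull b u γ x‖ ≤ B.toNNReal * ‖u (A.ψ (γ, x))‖ := by
    refine (ae_restrict_iff' hS).2 (.of_forall fun x hx => ?_)
    rw [pull, norm_smul]
    gcongr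
    exact (hB (γ, x) ⟨hx, hγ.2⟩).trans (Real.le_coe_toNNReal B)
  have hmem : MemLp (A.pull b u γ) p (volume.restrict {x | (γ, x) ∈ A.S}) :=
    hcomp.of_le_mul (hbc.aestronglyMeasurable.smul hcomp.1) hle
  rw [hb.pull_eq_indicator (hUG hγ.1) u]
  refine ⟨(memLp_indicator_iff_restrict hS).2 hmem, ?_⟩
  rw [eLpNorm_indicator_eq_eLpNorm_restrict hS]
  calc _ ≤ (B.toNNReal : ℝ≥0∞) * eLpNorm (fun x => u (A.ψ (γ, x))) p
        (volume.restrict {x | (γ, x) ∈ A.S}) :=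
        eLpNorm_le_nnreal_smul_eLpNorm_of_ae_le_mul hle p
    _ = (B.toNNReal : ℝ≥0∞) * eLpNorm u p
        ((volume.restrict {x | (γ, x) ∈ A.S}).map fun x => A.ψ (γ, x)) := by
        rw [eLpNorm_map_measure hu'.1 hψ]; rfl
    _ ≤ (B.toNNReal : ℝ≥0∞) * eLpNorm u p ((C : ℝ≥0∞) • volume) := by
        gcongr
        exact hC γ hγ.1
    _ ≤ _ := by
        rw [eLpNorm_smul_measure_of_ne_top hp]
        rw [ENNReal.coe_mul, ENNReal.coe_rpow_of_nonneg _ ENNReal.toReal_nonneg, mul_assoc]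
        rfl

end PlaneFamily

end PlaneOperators

/-! ### Curves in `L^p` given by smooth functions -/

section LpCurves

variable {E : Type*} [NormedAddCommGroup E] [NormedSpace ℝ E] {p : ℝ≥0∞} [hp1 : Fact (1 ≤ p)]

variable (p) in
open Classical in
/-- The class in `L^p` of a function on the plane; it is zero if the function is not in `L^p`. -/
noncomputable def lpClass (f : Plane → E) : Lp E p (volume : Measure Plane) :=
  if h : MemLp f p volume then h.toLp f else 0

theorem MeasureTheory.MemLp.lpClass_eq {f : Plane → E} (h : MemLp f p volume) :
    lpClass p f = h.toLp f := dif_pos h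

theorem coeFn_lpClass {f : Plane → E} (h : MemLp f p volume) : lpClass p f =ᵐ[volume] f := by
  rw [h.lpClass_eq]
  exact h.coeFn_toLp

theorem lpClass_congr {f g : Plane → E} (h : f =ᵐ[volume] g) : lpClass p f = lpClass p g := by
  by_cases hf : MemLp f p volume
  · have hg : MemLp g p volume := hf.ae_eq h
    rw [hf.lpClass_eq, hg.lpClass_eq, MemLp.toLp_eq_toLp_iff]
    exact h
  · have hg : ¬MemLp g p volume := fun hg => hf (hg.ae_eq h.symm)
    rw [lpClass, lpClass, dif_neg hf, dif_neg hg]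

theorem lpClass_add {f g : Plane → E} (hf : MemLp f p volume) (hg : MemLp g p volume) :
    lpClass p (f + g) = lpClass p f + lpClass p g := by
  rw [hf.lpClass_eq, hg.lpClass_eq, (hf.add hg).lpClass_eq, MemLp.toLp_add]

theorem lpClass_sub {f g : Plane → E} (hf : MemLp f p volume) (hg : MemLp g p volume) :
    lpClass p (f - g) = lpClass p f - lpClass p g := by
  rw [hf.lpClass_eq, hg.lpClass_eq, (hf.sub hg).lpClass_eq, MemLp.toLp_sub]

theorem lpClass_const_smul {f : Plane → E} (hf : MemLp f p volume) (c : ℝ) :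
    lpClass p (c • f) = c • lpClass p f := by
  rw [hf.lpClass_eq, (hf.const_smul c).lpClass_eq, MemLp.toLp_const_smul]

theorem lpClass_sum {ι : Type*} (s : Finset ι) {f : ι → Plane → E}
    (hf : ∀ i, MemLp (f i) p volume) : lpClass p (∑ i ∈ s, f i) = ∑ i ∈ s, lpClass p (f i) := by
  classical
  induction s using Finset.induction_on with
  | empty =>
    rw [Finset.sum_empty, Finset.sum_empty,
      (MemLp.zero : MemLp (0 : Plane → E) p volume).lpClass_eq]
    rfl
  | insert i s hi ih =>
    rw [Finset.sum_insert hi, Finset.sum_insert hi,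
      lpClass_add (hf i) (memLp_finsetSum' s fun i _ => hf i), ih]

theorem enorm_lpClass {f : Plane → E} (hf : MemLp f p volume) :
    ‖lpClass p f‖ₑ = eLpNorm f p volume := by
  rw [hf.lpClass_eq, Lp.enorm_toLp]

theorem memLp_of_continuous_of_isCompact {f : Plane → E} (hf : Continuous f) {L : Set Plane}
    (hL : IsCompact L) (h0 : ∀ x ∉ L, f x = 0) : MemLp f p volume :=
  hf.memLp_of_hasCompactSupport (HasCompactSupport.intro hL h0)

theorem norm_lpClass_le (hp : p ≠ ⊤) {f : Plane → E} (hf : Continuous f) {L : Set Plane}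
    (hL : IsCompact L) (h0 : ∀ x ∉ L, f x = 0) {c : ℝ} (hc : 0 ≤ c) (h : ∀ x, ‖f x‖ ≤ c) :
    ‖lpClass p f‖ ≤ c * (volume L ^ (1 / p.toReal)).toReal := by
  have hm : MemLp f p volume := memLp_of_continuous_of_isCompact hf hL h0
  have h1 := eLpNorm_sub_le_of_dist_bdd (volume : Measure Plane) hp hL.measurableSet hc
    (f := f) (g := 0) (by simpa using h) (fun x hx => by_contra fun h => hx (h0 x h)) (by simp)
  rw [sub_zero] at h1
  have hfin : volume L ^ (1 / p.toReal) ≠ ⊤ :=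
    ENNReal.rpow_ne_top_of_nonneg (by positivity) hL.measure_lt_top.ne
  rw [← toReal_enorm, enorm_lpClass hm, ← ENNReal.toReal_ofReal hc, ← ENNReal.toReal_mul]
  exact ENNReal.toReal_mono (by finiteness) h1

variable {n : ℕ}

/-- A `C^1` function `v` of a parameter and a point, supported over a fixed compact set, is a
differentiable curve in `L^p`. -/
theorem hasFDerivAt_lpClass (hp : p ≠ ⊤) {G : Set (EuclideanSpace ℝ (Fin n))} (hG : IsOpen G)
    {L : Set Plane} (hL : IsCompact L) {v : EuclideanSpace ℝ (Fin n) × Plane → E}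
    (hv : ContDiffOn ℝ 1 v (G ×ˢ univ)) (h0 : ∀ z ∈ G ×ˢ (univ : Set Plane), z.2 ∉ L → v z = 0)
    {γ : EuclideanSpace ℝ (Fin n)} (hγ : γ ∈ G) :
    HasFDerivAt (fun γ => lpClass p fun x => v (γ, x))
      (∑ i, (EuclideanSpace.proj i : EuclideanSpace ℝ (Fin n) →L[ℝ] ℝ).smulRight
        (lpClass p fun x => fderiv ℝ v (γ, x) (EuclideanSpace.single i 1, 0))) γ := by
  have hO : IsOpen (G ×ˢ (univ : Set Plane)) := hG.prod isOpen_univ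
  have hd : ∀ γ ∈ G, ∀ x, HasFDerivAt v (fderiv ℝ v (γ, x)) (γ, x) := fun γ hγ x =>
    ((hv.contDiffAt (hO.mem_nhds ⟨hγ, mem_univ x⟩)).differentiableAt one_ne_zero).hasFDerivAt
  have hcont : ∀ γ ∈ G, Continuous fun x => v (γ, x) := fun γ hγ =>
    hv.continuousOn.comp_continuous (by fun_prop) fun x => ⟨hγ, mem_univ _⟩
  have hD : ContinuousOn (fderiv ℝ v) (G ×ˢ univ) := hv.continuousOn_fderiv_of_isOpen hO le_rfl
  have hD0 : ∀ γ ∈ G, ∀ x ∉ L, fderiv ℝ v (γ, x) = 0 := fun γ hγ x hx => by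
    have : v =ᶠ[𝓝 (γ, x)] fun _ => 0 := by
      filter_upwards [(hG.prod hL.isClosed.isOpen_compl).mem_nhds ⟨hγ, hx⟩] with z hz
      exact h0 z ⟨hz.1, mem_univ _⟩ hz.2
    rw [this.fderiv_eq, fderiv_fun_const]
    rfl
  have hDc : ∀ e, Continuous fun x => fderiv ℝ v (γ, x) e := fun e =>
    (hD.comp_continuous (by fun_prop : Continuous fun x : Plane => (γ, x))
      fun x => ⟨hγ, mem_univ _⟩).clm_apply continuous_const
  have hDm : ∀ e, MemLp (fun x => fderiv ℝ v (γ, x) e) p volume := fun e =>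
    memLp_of_continuous_of_isCompact (hDc e) hL fun x hx => by simp [hD0 γ hγ x hx]
  have hm : ∀ γ ∈ G, MemLp (fun x => v (γ, x)) p volume := fun γ hγ =>
    memLp_of_continuous_of_isCompact (hcont γ hγ) hL fun x hx => h0 _ ⟨hγ, mem_univ _⟩ hx
  refine HasFDerivAt.of_isLittleO (Asymptotics.isLittleO_iff.2 fun c hc => ?_)
  set κ := (volume L ^ (1 / p.toReal)).toReal with hκ
  have hκ0 : 0 ≤ κ := ENNReal.toReal_nonneg
  have hδ : 0 < c / (κ + 1) := by positivity
  -- by compactness of `L`, the derivative of `v` is continuous in the parameter uniformly in `x`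
  have hunif : ∀ᶠ γ' in 𝓝 γ, γ' ∈ G ∧
      ∀ x ∈ L, ‖fderiv ℝ v (γ', x) - fderiv ℝ v (γ, x)‖ ≤ c / (κ + 1) := by
    refine (hG.eventually_mem hγ).and (hL.eventually_forall_of_forall_eventually fun y _ => ?_)
    have h1 : ContinuousAt (fderiv ℝ v) (γ, y) := hD.continuousAt (hO.mem_nhds ⟨hγ, mem_univ _⟩)
    have h2 : ContinuousAt (fun z : EuclideanSpace ℝ (Fin n) × Plane => fderiv ℝ v (γ, z.2))
        (γ, y) :=
      ContinuousAt.comp (f := fun z : EuclideanSpace ℝ (Fin n) × Plane => (γ, z.2))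
        (g := fderiv ℝ v) h1 (by fun_prop)
    have h3 := (h1.sub h2).norm
    have h4 : ‖(fderiv ℝ v - fun z : EuclideanSpace ℝ (Fin n) × Plane => fderiv ℝ v (γ, z.2))
        (γ, y)‖ = 0 := by simp
    rw [ContinuousAt, h4] at h3
    exact (h3.eventually (gt_mem_nhds hδ)).mono fun z hz => le_of_lt hz
  obtain ⟨r, hr, hrG⟩ := Metric.nhds_basis_ball.mem_iff.1 hunif
  filter_upwards [Metric.ball_mem_nhds γ hr] with γ' hγ'
  have hG' := (hrG hγ').1
  have hsum : (∑ i, (EuclideanSpace.proj i : EuclideanSpace ℝ (Fin n) →L[ℝ] ℝ).smulRight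
      (lpClass p fun x => fderiv ℝ v (γ, x) (EuclideanSpace.single i 1, 0))) (γ' - γ) =
      lpClass p fun x => fderiv ℝ v (γ, x) (γ' - γ, 0) := by
    have e1 : (fun x => fderiv ℝ v (γ, x) (γ' - γ, 0)) = ∑ i, (γ' - γ) i •
        fun x => fderiv ℝ v (γ, x) (EuclideanSpace.single i 1, 0) := by
      funext x
      have e2 : ((γ' - γ, 0) : EuclideanSpace ℝ (Fin n) × Plane) =
          ∑ i, (γ' - γ) i • (EuclideanSpace.single i 1, 0) := by
        refine Prod.ext ?_ (by simp [Prod.snd_sum])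
        rw [Prod.fst_sum]
        ext j
        simp [Pi.single_apply]
      rw [e2, map_sum, Finset.sum_apply]
      simp only [map_smul, Pi.smul_apply]
    rw [e1, lpClass_sum _ fun i => (hDm _).const_smul _, sum_apply]
    refine Finset.sum_congr rfl fun i _ => ?_
    rw [lpClass_const_smul (hDm _)]
    rfl
  rw [hsum, ← lpClass_sub (hm γ' hG') (hm γ hγ),
    ← lpClass_sub ((hm γ' hG').sub (hm γ hγ)) (hDm _)]
  have hzero : ∀ x ∉ L, ((fun x => v (γ', x)) - (fun x => v (γ, x)) -
      fun x => fderiv ℝ v (γ, x) (γ' - γ, 0)) x = 0 := fun x hx => by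
    simp [h0 (γ', x) ⟨hG', mem_univ x⟩ hx, h0 (γ, x) ⟨hγ, mem_univ x⟩ hx, hD0 γ hγ x hx]
  have hbound : ∀ x, ‖((fun x => v (γ', x)) - (fun x => v (γ, x)) -
      fun x => fderiv ℝ v (γ, x) (γ' - γ, 0)) x‖ ≤ c / (κ + 1) * ‖γ' - γ‖ := by
    intro x
    by_cases hx : x ∈ L
    · have hmv := (convex_ball γ r).norm_image_sub_le_of_norm_hasFDerivWithin_le'
        (f := fun γ => v (γ, x))
        (f' := fun γ => (fderiv ℝ v (γ, x)).comp (ContinuousLinearMap.inl ℝ _ Plane))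
        (φ := (fderiv ℝ v (γ, x)).comp (ContinuousLinearMap.inl ℝ _ Plane))
        (C := c / (κ + 1)) (fun y hy => (HasFDerivAt.comp (f := fun γ => (γ, x)) y
          (hd y (hrG hy).1 x) (hasFDerivAt_prodMk_left y x)).hasFDerivWithinAt) ?_
        (Metric.mem_ball_self hr) hγ'
      · exact hmv
      · intro y hy
        rw [← ContinuousLinearMap.sub_comp]
        refine (ContinuousLinearMap.opNorm_comp_le _ _).trans ?_
        refine (mul_le_of_le_one_right (norm_nonneg _)
          (ContinuousLinearMap.norm_inl_le_one ℝ _ _)).trans ((hrG hy).2 x hx)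
    · rw [hzero x hx, norm_zero]
      positivity
  refine (norm_lpClass_le hp (((hcont γ' hG').sub (hcont γ hγ)).sub (hDc _)) hL ?_
    (by positivity) hbound).trans ?_
  · exact hzero
  · have : c / (κ + 1) * κ ≤ c := by
      rw [div_mul_eq_mul_div, div_le_iff₀ (by positivity)]
      nlinarith
    calc c / (κ + 1) * ‖γ' - γ‖ * κ = c / (κ + 1) * κ * ‖γ' - γ‖ := by ring
      _ ≤ c * ‖γ' - γ‖ := by gcongr

end LpCurves

/-! ### Differentiation of weighted compositions -/

section WeakDerivatives

variable {E : Type*} [NormedAddCommGroup E] [NormedSpace ℝ E] {p : ℝ≥0∞} [hp1 : Fact (1 ≤ p)]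

theorem continuous_integral_smul_Lp {θ : Plane → ℝ} (hθ : Continuous θ)
    (hc : HasCompactSupport θ) :
    Continuous fun f : Lp E p (volume : Measure Plane) => ∫ x, θ x • f x := by
  have hdiff : ∀ f g : Lp E p (volume : Measure Plane), ∀ K : ℝ≥0∞,
      eLpNorm θ (ENNReal.conjExponent p) volume ≤ K →
      ‖(∫ x, θ x • f x) - ∫ x, θ x • g x‖ₑ ≤ K * edist f g := by
    intro f g K hK
    have hi : ∀ f : Lp E p (volume : Measure Plane), Integrable (fun x => θ x • f x) volume :=
      fun f => integrable_test_smul hp1.out hθ hc (Lp.memLp f)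
    rw [← integral_sub (hi f) (hi g)]
    refine (enorm_integral_le_lintegral_enorm _).trans ?_
    rw [← eLpNorm_one_eq_lintegral_enorm, Lp.edist_def]
    have hpq : ENNReal.HolderConjugate p (ENNReal.conjExponent p) :=
      ENNReal.HolderConjugate.conjExponent hp1.out
    have := eLpNorm_smul_le_mul_eLpNorm (p := ENNReal.conjExponent p) (q := p) (r := 1)
      ((Lp.memLp f).1.sub (Lp.memLp g).1) hθ.aestronglyMeasurable (𝕜 := ℝ)
    refine le_trans (le_of_eq ?_) (this.trans (by gcongr))
    refine eLpNorm_congr_ae (.of_forall fun x => ?_)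
    simp [smul_sub]
  have hm : MemLp θ (ENNReal.conjExponent p) volume := hθ.memLp_of_hasCompactSupport hc
  refine (LipschitzWith.continuous (K := (eLpNorm θ (ENNReal.conjExponent p) volume).toNNReal) ?_)
  intro f g
  rw [edist_eq_enorm_sub, ENNReal.coe_toNNReal hm.eLpNorm_ne_top]
  exact hdiff f g _ le_rfl

theorem integral_smul_lpClass {θ : Plane → ℝ} {f : Plane → E} (hf : MemLp f p volume) :
    ∫ x, θ x • lpClass p f x = ∫ x, θ x • f x :=
  integral_congr_ae ((coeFn_lpClass hf).mono fun x hx => by simp only [hx])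

theorem tendsto_integral_smul {θ : Plane → ℝ} (hθ : Continuous θ) (hc : HasCompactSupport θ)
    {ι : Type*} {l : Filter ι} {v : ι → Plane → E} {u : Plane → E} (hv : ∀ i, MemLp (v i) p volume)
    (hu : MemLp u p volume) (h : Tendsto (fun i => lpClass p (v i)) l (𝓝 (lpClass p u))) :
    Tendsto (fun i => ∫ x, θ x • v i x) l (𝓝 (∫ x, θ x • u x)) := by
  have := ((continuous_integral_smul_Lp hθ hc).tendsto (lpClass p u)).comp h
  simpa only [Function.comp_def, integral_smul_lpClass (hv _), integral_smul_lpClass hu] using this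

/-- Weak partial derivatives are stable under limits in `L^p`. -/
theorem HasWeakPartial.of_tendsto {ι : Type*} {l : Filter ι} [l.NeBot] {j : ℕ} {w : Fin j → Fin 2}
    {v h : ι → Plane → E} {u g : Plane → E} (hv : ∀ i, MemLp (v i) p volume)
    (hu : MemLp u p volume) (hh : ∀ i, MemLp (h i) p volume) (hg : MemLp g p volume)
    (hvu : Tendsto (fun i => lpClass p (v i)) l (𝓝 (lpClass p u)))
    (hhg : Tendsto (fun i => lpClass p (h i)) l (𝓝 (lpClass p g)))
    (hw : ∀ i, HasWeakPartial w (v i) (h i)) : HasWeakPartial w u g := by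
  intro θ hθ hc
  have h1 := tendsto_integral_smul (continuous_test_deriv w hθ) (compact_test_deriv w hc) hv hu hvu
  have h2 := (tendsto_integral_smul hθ.continuous hc hh hg hhg).const_smul ((-1 : ℝ) ^ j)
  exact tendsto_nhds_unique h1 (h2.congr fun i => (hw i θ hθ hc).symm)

theorem hasWeakDeriv_iff_hasWeakPartial {q : Fin 2} {u g : Plane → E} :
    HasWeakDeriv q u g ↔ HasWeakPartial (fun _ : Fin 1 => q) u g := by
  simp [HasWeakDeriv, HasWeakPartial]

theorem iteratedFDeriv_cons {j : ℕ} {q : Fin 2} {w : Fin j → Fin 2} {θ : Plane → ℝ}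
    (hθ : ContDiff ℝ ∞ θ) (x : Plane) :
    iteratedFDeriv ℝ (j + 1) θ x
        (fun l => EuclideanSpace.single ((Fin.cons q w : Fin (j + 1) → Fin 2) l) (1 : ℝ)) =
      fderiv ℝ (fun x => iteratedFDeriv ℝ j θ x fun l => EuclideanSpace.single (w l) (1 : ℝ)) x
        (EuclideanSpace.single q 1) := by
  have hd : DifferentiableAt ℝ (iteratedFDeriv ℝ j θ) x :=
    (hθ.differentiable_iteratedFDeriv (by exact_mod_cast ENat.natCast_lt_top j)) x
  rw [iteratedFDeriv_succ_apply_left]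
  have h2 := (ContinuousMultilinearMap.apply ℝ (fun _ : Fin j => Plane) ℝ
    (fun l => EuclideanSpace.single (w l) (1 : ℝ))).hasFDerivAt.comp x hd.hasFDerivAt
  have h3 := h2.fderiv
  rw [Function.comp_def] at h3
  simp only [ContinuousMultilinearMap.apply_apply] at h3
  rw [h3]
  rfl

theorem contDiff_test_deriv {j : ℕ} (w : Fin j → Fin 2) {θ : Plane → ℝ} (hθ : ContDiff ℝ ∞ θ) :
    ContDiff ℝ ∞ fun x => iteratedFDeriv ℝ j θ x fun l => EuclideanSpace.single (w l) (1 : ℝ) := by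
  have h1 : ContDiff ℝ ∞ (iteratedFDeriv ℝ j θ) :=
    hθ.iteratedFDeriv_right (m := ∞) (by exact_mod_cast le_top)
  exact (ContinuousMultilinearMap.apply ℝ (fun _ : Fin j => Plane) ℝ
    (fun l => EuclideanSpace.single (w l) (1 : ℝ))).contDiff.comp h1

theorem HasWeakDeriv.hasWeakPartial_cons_iff {q : Fin 2} {u g h : Plane → E}
    (hg : HasWeakDeriv q u g) {j : ℕ} {w : Fin j → Fin 2} :
    HasWeakPartial (Fin.cons q w : Fin (j + 1) → Fin 2) u h ↔ HasWeakPartial w g h := by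
  refine forall₃_congr fun θ hθ hc => ?_
  simp_rw [iteratedFDeriv_cons hθ]
  rw [hg _ (contDiff_test_deriv w hθ) (compact_test_deriv w hc), pow_succ, mul_neg_one, neg_smul,
    neg_inj]

theorem MemPlaneSobolev.mono {k l : ℕ} (hkl : k ≤ l) {u : Plane → E}
    (hu : MemPlaneSobolev l p u) : MemPlaneSobolev k p u :=
  ⟨hu.1, fun j hj w => hu.2 j (hj.trans hkl) w⟩

theorem MemPlaneSobolev.exists_hasWeakDeriv {k : ℕ} {u : Plane → E}
    (hu : MemPlaneSobolev (k + 1) p u) :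
    ∃ g : Fin 2 → Plane → E, ∀ q, MemPlaneSobolev k p (g q) ∧ HasWeakDeriv q u (g q) := by
  have key : ∀ q, ∃ g : Plane → E, MemLp g p volume ∧ HasWeakDeriv q u g := fun q => by
    simpa only [hasWeakDeriv_iff_hasWeakPartial] using hu.2 1 (by omega) fun _ => q
  choose g hg hug using key
  refine ⟨g, fun q => ⟨⟨hg q, fun j hj w => ?_⟩, hug q⟩⟩
  obtain ⟨h, hh, hw⟩ := hu.2 (j + 1) (by omega) (Fin.cons q w)
  exact ⟨h, hh, (hug q).hasWeakPartial_cons_iff.1 hw⟩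

theorem hasWeakDeriv_of_contDiff {f : Plane → E} (hf : ContDiff ℝ 1 f) (hc : HasCompactSupport f)
    (q : Fin 2) : HasWeakDeriv q f fun x => fderiv ℝ f x (EuclideanSpace.single q 1) := by
  intro θ hθ hθc
  have hθ1 : ContDiff ℝ 1 θ := hθ.of_le (by exact_mod_cast le_top)
  have c1 : Continuous fun x => fderiv ℝ θ x (EuclideanSpace.single q 1) :=
    (hθ1.continuous_fderiv one_ne_zero).clm_apply continuous_const
  have c2 : Continuous fun x => fderiv ℝ f x (EuclideanSpace.single q 1) :=
    (hf.continuous_fderiv one_ne_zero).clm_apply continuous_const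
  rw [integral_smul_fderiv_eq_neg_fderiv_smul_of_integrable, neg_neg]
  · exact (c1.smul hf.continuous).integrable_of_hasCompactSupport hc.smul_left
  · exact (hθ.continuous.smul c2).integrable_of_hasCompactSupport hθc.smul_right
  · exact (hθ.continuous.smul hf.continuous).integrable_of_hasCompactSupport hc.smul_left
  · exact fun x _ => (hθ1.differentiable one_ne_zero) x
  · exact fun x _ => (hf.differentiable one_ne_zero) x

end WeakDerivatives

namespace PlaneFamily

variable {n : ℕ} {A : PlaneFamily n} {E : Type*} [NormedAddCommGroup E] [NormedSpace ℝ E]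
  {p : ℝ≥0∞} [hp1 : Fact (1 ≤ p)] {b : EuclideanSpace ℝ (Fin n) × Plane → ℝ}

theorem IsWeight.eventuallyEq_zero (hb : A.IsWeight b) {z : EuclideanSpace ℝ (Fin n) × Plane}
    (hz : z ∈ A.G ×ˢ (univ : Set Plane)) (hS : z ∉ A.S) : b =ᶠ[𝓝 z] fun _ => 0 := by
  filter_upwards [A.isOpen_diff.mem_nhds ⟨hz, hS⟩] with y hy
  exact hb.eq_zero y hy.1 hy.2

theorem IsWeight.fderiv_apply (hb : A.IsWeight b) (e : EuclideanSpace ℝ (Fin n) × Plane) :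
    A.IsWeight fun z => fderiv ℝ b z e where
  contDiffOn := (hb.contDiffOn.fderiv_of_isOpen A.isOpen_prod (by simp)).clm_apply contDiffOn_const
  eq_zero z hz hS := by
    rw [(hb.eventuallyEq_zero hz hS).fderiv_eq, fderiv_fun_const]
    rfl

theorem IsWeight.contDiffOn_smul (hb : A.IsWeight b)
    {c : EuclideanSpace ℝ (Fin n) × Plane → E} (hc : ContDiffOn ℝ ∞ c A.Ω) :
    ContDiffOn ℝ ∞ (fun z => b z • c z) (A.G ×ˢ univ) := by
  intro z hz
  refine ContDiffAt.contDiffWithinAt ?_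
  by_cases hS : z ∈ A.S
  · have hΩ := A.isOpen_Ω.mem_nhds (A.S_subset hS)
    exact (hb.contDiffOn.contDiffAt (A.isOpen_prod.mem_nhds hz)).smul (hc.contDiffAt hΩ)
  · refine (contDiffAt_const (c := (0 : E))).congr_of_eventuallyEq ?_
    filter_upwards [hb.eventuallyEq_zero hz hS] with y hy
    rw [hy, zero_smul]

theorem IsWeight.mul_fderiv_apply (hb : A.IsWeight b) (e : EuclideanSpace ℝ (Fin n) × Plane)
    (q : Fin 2) : A.IsWeight fun z => b z * (fderiv ℝ A.ψ z e) q where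
  contDiffOn := hb.contDiffOn_smul ((EuclideanSpace.proj (𝕜 := ℝ) q).contDiff.comp_contDiffOn
    ((A.contDiffOn_ψ.fderiv_of_isOpen A.isOpen_Ω (by simp)).clm_apply contDiffOn_const))
  eq_zero z hz hS := by rw [hb.eq_zero z hz hS, zero_mul]

variable (A) in
/-- The derivative of `(γ, x) ↦ b (γ, x) • u (ψ (γ, x))` in the direction `e`, expressed by the
weighted compositions of `u` and of its partial derivatives `g 0`, `g 1`. -/
noncomputable def pullDir (b : EuclideanSpace ℝ (Fin n) × Plane → ℝ) (u : Plane → E)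
    (g : Fin 2 → Plane → E) (e : EuclideanSpace ℝ (Fin n) × Plane) (γ : EuclideanSpace ℝ (Fin n)) :
    Plane → E :=
  A.pull (fun z => fderiv ℝ b z e) u γ + ∑ q, A.pull (fun z => b z * (fderiv ℝ A.ψ z e) q) (g q) γ

theorem IsWeight.contDiffOn_pull (hb : A.IsWeight b) {u : Plane → E} (hu : ContDiff ℝ ∞ u) :
    ContDiffOn ℝ ∞ (fun z => b z • u (A.ψ z)) (A.G ×ˢ univ) :=
  hb.contDiffOn_smul (hu.comp_contDiffOn A.contDiffOn_ψ)

theorem IsWeight.fderiv_pull (hb : A.IsWeight b) {u : Plane → E} (hu : ContDiff ℝ ∞ u)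
    {γ : EuclideanSpace ℝ (Fin n)} (hγ : γ ∈ A.G) (x : Plane)
    (e : EuclideanSpace ℝ (Fin n) × Plane) :
    fderiv ℝ (fun z => b z • u (A.ψ z)) (γ, x) e =
      A.pullDir b u (fun q y => fderiv ℝ u y (EuclideanSpace.single q 1)) e γ x := by
  have hz : (γ, x) ∈ A.G ×ˢ (univ : Set Plane) := ⟨hγ, mem_univ x⟩
  by_cases hS : (γ, x) ∈ A.S
  · have hψ : HasFDerivAt A.ψ (fderiv ℝ A.ψ (γ, x)) (γ, x) :=
      ((A.contDiffOn_ψ.contDiffAt (A.isOpen_Ω.mem_nhds (A.S_subset hS))).differentiableAt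
        (by simp)).hasFDerivAt
    have hb' : HasFDerivAt b (fderiv ℝ b (γ, x)) (γ, x) :=
      ((hb.contDiffOn.contDiffAt (A.isOpen_prod.mem_nhds hz)).differentiableAt
        (by simp)).hasFDerivAt
    have hu' : HasFDerivAt u (fderiv ℝ u (A.ψ (γ, x))) (A.ψ (γ, x)) :=
      ((hu.differentiable (by simp)) _).hasFDerivAt
    have h3 : HasFDerivAt (fun z => b z • u (A.ψ z)) _ (γ, x) :=
      hb'.smul (hu'.comp (γ, x) hψ)
    rw [h3.fderiv]
    have e1 : fderiv ℝ A.ψ (γ, x) e =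
        ∑ q, (fderiv ℝ A.ψ (γ, x) e) q • EuclideanSpace.single q (1 : ℝ) := by
      ext j
      fin_cases j <;> simp
    have e2 : fderiv ℝ u (A.ψ (γ, x)) (fderiv ℝ A.ψ (γ, x) e) = ∑ q,
        (fderiv ℝ A.ψ (γ, x) e) q • fderiv ℝ u (A.ψ (γ, x)) (EuclideanSpace.single q 1) := by
      conv_lhs => rw [e1, map_sum]
      simp only [map_smul]
    simp [pullDir, pull, e2, mul_smul, add_comm]
  · have h1 : (fun z => b z • u (A.ψ z)) =ᶠ[𝓝 (γ, x)] fun _ => 0 := by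
      filter_upwards [hb.eventuallyEq_zero hz hS] with y hy
      rw [hy, zero_smul]
    rw [h1.fderiv_eq, fderiv_fun_const]
    simp [pullDir, pull, (hb.fderiv_apply e).eq_zero _ hz hS, hb.eq_zero _ hz hS]

theorem IsWeight.memLp_pull (hb : A.IsWeight b) (hp : p ≠ ⊤) {γ : EuclideanSpace ℝ (Fin n)}
    (hγ : γ ∈ A.G) {u : Plane → E} (hu : MemLp u p volume) : MemLp (A.pull b u γ) p volume := by
  obtain ⟨U, hU, -, C, hC⟩ := hb.exists_eLpNorm_pull_le (E := E) hp hγ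
  exact (hC γ (mem_of_mem_nhds hU) u hu).1

theorem IsWeight.memLp_pullDir (hb : A.IsWeight b) (hp : p ≠ ⊤) {γ : EuclideanSpace ℝ (Fin n)}
    (hγ : γ ∈ A.G) {u : Plane → E} (hu : MemLp u p volume) {g : Fin 2 → Plane → E}
    (hg : ∀ q, MemLp (g q) p volume) (e : EuclideanSpace ℝ (Fin n) × Plane) :
    MemLp (A.pullDir b u g e γ) p volume :=
  ((hb.fderiv_apply e).memLp_pull hp hγ hu).add
    (memLp_finsetSum' _ fun q _ => (hb.mul_fderiv_apply e q).memLp_pull hp hγ (hg q))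

theorem IsWeight.lpClass_pullDir (hb : A.IsWeight b) (hp : p ≠ ⊤) {γ : EuclideanSpace ℝ (Fin n)}
    (hγ : γ ∈ A.G) {u : Plane → E} (hu : MemLp u p volume) {g : Fin 2 → Plane → E}
    (hg : ∀ q, MemLp (g q) p volume) (e : EuclideanSpace ℝ (Fin n) × Plane) :
    lpClass p (A.pullDir b u g e γ) = lpClass p (A.pull (fun z => fderiv ℝ b z e) u γ) +
      ∑ q, lpClass p (A.pull (fun z => b z * (fderiv ℝ A.ψ z e) q) (g q) γ) := by
  rw [pullDir, lpClass_add ((hb.fderiv_apply e).memLp_pull hp hγ hu)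
    (memLp_finsetSum' _ fun q _ => (hb.mul_fderiv_apply e q).memLp_pull hp hγ (hg q)),
    lpClass_sum _ fun q => (hb.mul_fderiv_apply e q).memLp_pull hp hγ (hg q)]

theorem pull_sub (u v : Plane → E) (γ : EuclideanSpace ℝ (Fin n)) :
    A.pull b (u - v) γ = A.pull b u γ - A.pull b v γ := by
  funext x
  simp [pull, smul_sub]

theorem IsWeight.tendstoLocallyUniformlyOn (hb : A.IsWeight b) (hp : p ≠ ⊤) {u : Plane → E}
    (hu : MemLp u p volume) {v : ℕ → Plane → E} (hv : ∀ i, MemLp (v i) p volume)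
    (h : Tendsto (fun i => eLpNorm (v i - u) p volume) atTop (𝓝 0)) :
    TendstoLocallyUniformlyOn (fun i γ => lpClass p (A.pull b (v i) γ))
      (fun γ => lpClass p (A.pull b u γ)) atTop A.G := by
  refine EMetric.tendstoLocallyUniformlyOn_iff.2 fun δ hδ γ hγ => ?_
  obtain ⟨U, hU, hUG, C, hC⟩ := hb.exists_eLpNorm_pull_le (E := E) hp hγ
  refine ⟨U, mem_nhdsWithin_of_mem_nhds hU, ?_⟩
  have h1 : Tendsto (fun i => (C : ℝ≥0∞) * eLpNorm (v i - u) p volume) atTop (𝓝 0) := by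
    simpa using ENNReal.Tendsto.const_mul h (.inr ENNReal.coe_ne_top)
  filter_upwards [h1.eventually (gt_mem_nhds hδ)] with i hi y hy
  rw [edist_comm, edist_eq_enorm_sub, ← lpClass_sub (hC y hy _ (hv i)).1 (hC y hy _ hu).1,
    ← pull_sub, enorm_lpClass (hC y hy _ ((hv i).sub hu)).1]
  exact (hC y hy _ ((hv i).sub hu)).2.trans_lt hi

end PlaneFamily

/-! ### Smoothness of weighted compositions in the parameter -/

section SobolevCurves

variable {E : Type*} [NormedAddCommGroup E] [NormedSpace ℝ E] {p : ℝ≥0∞} [hp1 : Fact (1 ≤ p)]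

theorem HasWeakPartial.congr_right {j : ℕ} {w : Fin j → Fin 2} {u g g' : Plane → E}
    (h : HasWeakPartial w u g) (hg : g =ᵐ[volume] g') : HasWeakPartial w u g' := by
  intro θ hθ hc
  rw [h θ hθ hc]
  congr 1
  exact integral_congr_ae (hg.mono fun x hx => by simp only [hx])

theorem tendsto_lpClass {ι : Type*} {l : Filter ι} {v : ι → Plane → E} {u : Plane → E}
    (hv : ∀ i, MemLp (v i) p volume) (hu : MemLp u p volume)
    (h : Tendsto (fun i => eLpNorm (v i - u) p volume) l (𝓝 0)) :
    Tendsto (fun i => lpClass p (v i)) l (𝓝 (lpClass p u)) := by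
  refine tendsto_iff_edist_tendsto_0.2 (h.congr fun i => ?_)
  rw [edist_eq_enorm_sub, ← lpClass_sub (hv i) hu, enorm_lpClass ((hv i).sub hu)]

theorem TendstoLocallyUniformlyOn.finset_sum {α β ι κ : Type*} [TopologicalSpace α]
    [NormedAddCommGroup β] {l : Filter ι} {s : Set α} (t : Finset κ) {F : κ → ι → α → β}
    {f : κ → α → β} (h : ∀ k, TendstoLocallyUniformlyOn (F k) (f k) l s) :
    TendstoLocallyUniformlyOn (fun i x => ∑ k ∈ t, F k i x) (fun x => ∑ k ∈ t, f k x) l s := by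
  classical
  induction t using Finset.induction_on with
  | empty =>
    simp only [Finset.sum_empty]
    exact fun u hu x _ => ⟨univ, univ_mem, .of_forall fun _ _ _ => refl_mem_uniformity hu⟩
  | insert k t hk ih =>
    simp only [Finset.sum_insert hk]
    exact (h k).add ih

variable [CompleteSpace E]

theorem exists_contDiff_memLp_tendsto (hp : p ≠ ⊤)
    {u : Plane → E} (hu : MemLp u p volume) {g : Fin 2 → Plane → E}
    (hg : ∀ q, MemLp (g q) p volume) (h : ∀ q, HasWeakDeriv q u (g q)) :
    ∃ v : ℕ → Plane → E, (∀ i, ContDiff ℝ ∞ (v i)) ∧ (∀ i, MemLp (v i) p volume) ∧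
      (∀ q i, MemLp (fun x => fderiv ℝ (v i) x (EuclideanSpace.single q 1)) p volume) ∧
      Tendsto (fun i => eLpNorm (v i - u) p volume) atTop (𝓝 0) ∧
      ∀ q, Tendsto (fun i => eLpNorm
        ((fun x => fderiv ℝ (v i) x (EuclideanSpace.single q 1)) - g q) p volume)
        atTop (𝓝 0) := by
  obtain ⟨v, hv, h0, h1⟩ := exists_contDiff_tendsto hp hu hg h
  -- only a tail of the sequence is at finite distance from `u`, hence in `L^p`
  have hfin : ∀ᶠ i in atTop, eLpNorm (v i - u) p volume < ⊤ ∧ ∀ q, eLpNorm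
      ((fun x => fderiv ℝ (v i) x (EuclideanSpace.single q 1)) - g q) p volume < ⊤ :=
    (h0.eventually (gt_mem_nhds ENNReal.zero_lt_top)).and
      (eventually_all.2 fun q => (h1 q).eventually (gt_mem_nhds ENNReal.zero_lt_top))
  obtain ⟨i₀, hi₀⟩ := eventually_atTop.1 hfin
  have key : ∀ {a c : Plane → E}, Continuous a → MemLp c p volume →
      eLpNorm (a - c) p volume < ⊤ → MemLp a p volume := fun ha hc hac => by
    have hsub : MemLp (_ - _) p volume := ⟨ha.aestronglyMeasurable.sub hc.1, hac⟩
    simpa using hsub.add hc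
  refine ⟨fun i => v (i + i₀), fun i => hv _,
    fun i => key (hv _).continuous hu (hi₀ _ (Nat.le_add_left _ _)).1,
    fun q i => key ?_ (hg q) ((hi₀ _ (Nat.le_add_left _ _)).2 q),
    h0.comp (tendsto_add_atTop_nat i₀), fun q => (h1 q).comp (tendsto_add_atTop_nat i₀)⟩
  exact ((hv _).continuous_fderiv (by simp)).clm_apply continuous_const

end SobolevCurves

namespace PlaneFamily

variable {n : ℕ} {A : PlaneFamily n} {E : Type*} [NormedAddCommGroup E] [NormedSpace ℝ E]
  {p : ℝ≥0∞} [hp1 : Fact (1 ≤ p)] {b : EuclideanSpace ℝ (Fin n) × Plane → ℝ}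

theorem IsWeight.hasFDerivAt_pull_of_contDiff (hb : A.IsWeight b) (hp : p ≠ ⊤) {u : Plane → E}
    (hu : ContDiff ℝ ∞ u) {γ : EuclideanSpace ℝ (Fin n)} (hγ : γ ∈ A.G) :
    HasFDerivAt (fun γ => lpClass p (A.pull b u γ))
      (∑ i, (EuclideanSpace.proj i : EuclideanSpace ℝ (Fin n) →L[ℝ] ℝ).smulRight
        (lpClass p (A.pullDir b u (fun q y => fderiv ℝ u y (EuclideanSpace.single q 1))
          (EuclideanSpace.single i 1, 0) γ))) γ := by
  have h0 : ∀ z ∈ A.G ×ˢ (univ : Set Plane), z.2 ∉ A.L → b z • u (A.ψ z) = 0 := fun z hz hL => by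
    rw [hb.eq_zero z hz fun hS => hL (A.snd_mem_L z hS), zero_smul]
  have := hasFDerivAt_lpClass hp A.isOpen_G A.isCompact_L
    ((hb.contDiffOn_pull hu).of_le (by exact_mod_cast le_top)) h0 hγ
  simp only [hb.fderiv_pull hu hγ] at this
  exact this

variable [CompleteSpace E]

theorem IsWeight.tendstoLocallyUniformlyOn_pullDir (hb : A.IsWeight b) (hp : p ≠ ⊤) {u : Plane → E}
    (hu : MemLp u p volume) {g : Fin 2 → Plane → E} (hg : ∀ q, MemLp (g q) p volume)
    {v : ℕ → Plane → E} (hv : ∀ i, MemLp (v i) p volume) {d : ℕ → Fin 2 → Plane → E}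
    (hd : ∀ i q, MemLp (d i q) p volume)
    (h0 : Tendsto (fun i => eLpNorm (v i - u) p volume) atTop (𝓝 0))
    (h1 : ∀ q, Tendsto (fun i => eLpNorm (d i q - g q) p volume) atTop (𝓝 0))
    (e : EuclideanSpace ℝ (Fin n) × Plane) :
    TendstoLocallyUniformlyOn (fun i γ => lpClass p (A.pullDir b (v i) (d i) e γ))
      (fun γ => lpClass p (A.pullDir b u g e γ)) atTop A.G := by
  have hlim := ((hb.fderiv_apply e).tendstoLocallyUniformlyOn hp hu hv h0).add
    (TendstoLocallyUniformlyOn.finset_sum Finset.univ fun q =>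
      (hb.mul_fderiv_apply e q).tendstoLocallyUniformlyOn hp (hg q) (fun i => hd i q) (h1 q))
  refine (hlim.congr fun i γ hγ => ?_).congr_right fun γ hγ => ?_
  · exact (hb.lpClass_pullDir hp hγ (hv i) (hd i) e).symm
  · exact (hb.lpClass_pullDir hp hγ hu hg e).symm

/-- For `u` in `W^{1,p}` the weighted compositions form a differentiable curve in `L^p`; this is
classical for smooth `u`, and the derivatives converge locally uniformly. -/
theorem IsWeight.hasFDerivAt_pull (hb : A.IsWeight b) (hp : p ≠ ⊤) {u : Plane → E}
    (hu : MemLp u p volume) {g : Fin 2 → Plane → E} (hg : ∀ q, MemLp (g q) p volume)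
    (h : ∀ q, HasWeakDeriv q u (g q)) {γ : EuclideanSpace ℝ (Fin n)} (hγ : γ ∈ A.G) :
    HasFDerivAt (fun γ => lpClass p (A.pull b u γ))
      (∑ i, (EuclideanSpace.proj i : EuclideanSpace ℝ (Fin n) →L[ℝ] ℝ).smulRight
        (lpClass p (A.pullDir b u g (EuclideanSpace.single i 1, 0) γ))) γ := by
  obtain ⟨v, hvs, hv, hd, h0, h1⟩ := exists_contDiff_memLp_tendsto hp hu hg h
  refine hasFDerivAt_of_tendstoLocallyUniformlyOn
    (g' := fun γ => ∑ i, (EuclideanSpace.proj i : EuclideanSpace ℝ (Fin n) →L[ℝ] ℝ).smulRight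
        (lpClass p (A.pullDir b u g (EuclideanSpace.single i 1, 0) γ)))
    A.isOpen_G (TendstoLocallyUniformlyOn.finset_sum Finset.univ fun j => ?_)
    (fun i γ hγ => hb.hasFDerivAt_pull_of_contDiff hp (hvs i) hγ)
    (fun γ hγ => (hb.tendstoLocallyUniformlyOn hp hu hv h0).tendsto_at hγ) hγ
  exact (ContinuousLinearMap.smulRightL ℝ (EuclideanSpace ℝ (Fin n)) (Lp E p volume)
    (EuclideanSpace.proj j)).uniformContinuous.comp_tendstoLocallyUniformlyOn
    (hb.tendstoLocallyUniformlyOn_pullDir hp hu hg hv (fun i q => hd q i) h0 h1 _)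

/-- The chain rule for weak derivatives of weighted compositions. -/
theorem IsWeight.hasWeakDeriv_pull (hb : A.IsWeight b) (hp : p ≠ ⊤) {u : Plane → E}
    (hu : MemLp u p volume) {g : Fin 2 → Plane → E} (hg : ∀ q, MemLp (g q) p volume)
    (h : ∀ q, HasWeakDeriv q u (g q)) {γ : EuclideanSpace ℝ (Fin n)} (hγ : γ ∈ A.G) (q : Fin 2) :
    HasWeakDeriv q (A.pull b u γ) (A.pullDir b u g (0, EuclideanSpace.single q 1) γ) := by
  obtain ⟨v, hvs, hv, hd, h0, h1⟩ := exists_contDiff_memLp_tendsto hp hu hg h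
  rw [hasWeakDeriv_iff_hasWeakPartial]
  refine HasWeakPartial.of_tendsto (l := atTop) (fun i => hb.memLp_pull hp hγ (hv i))
    (hb.memLp_pull hp hγ hu)
    (fun i => hb.memLp_pullDir hp hγ (hv i) (fun q => hd q i) (0, EuclideanSpace.single q 1))
    (hb.memLp_pullDir hp hγ hu hg _)
    ((hb.tendstoLocallyUniformlyOn hp hu hv h0).tendsto_at hγ)
    ((hb.tendstoLocallyUniformlyOn_pullDir hp hu hg hv (fun i q => hd q i) h0 h1 _).tendsto_at hγ)
    fun i => ?_
  rw [← hasWeakDeriv_iff_hasWeakPartial]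
  have hO := A.isOpen_prod
  have hV := (hb.contDiffOn_pull (hvs i)).of_le (m := 1) (by exact_mod_cast le_top)
  have hsm : ContDiff ℝ 1 (A.pull b (v i) γ) := contDiffOn_univ.1
    (hV.comp (f := fun x => (γ, x)) (by fun_prop) fun x _ => ⟨hγ, mem_univ x⟩)
  have hcs : HasCompactSupport (A.pull b (v i) γ) :=
    HasCompactSupport.intro A.isCompact_L fun x hx => by
      rw [pull, hb.eq_zero (γ, x) ⟨hγ, mem_univ x⟩ fun hS => hx (A.snd_mem_L _ hS), zero_smul]
  have hder := hasWeakDeriv_of_contDiff hsm hcs q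
  convert hder using 1
  funext x
  rw [← hb.fderiv_pull (hvs i) hγ x]
  have h2 : HasFDerivAt (fun z => b z • v i (A.ψ z))
      (fderiv ℝ (fun z => b z • v i (A.ψ z)) (γ, x)) (γ, x) :=
    ((hV.contDiffAt (hO.mem_nhds ⟨hγ, mem_univ x⟩)).differentiableAt one_ne_zero).hasFDerivAt
  have h3 : HasFDerivAt (A.pull b (v i) γ) _ x :=
    HasFDerivAt.comp (f := fun x => (γ, x)) x h2 (hasFDerivAt_prodMk_right γ x)
  rw [h3.fderiv]
  simp

theorem IsWeight.continuousOn_pull (hb : A.IsWeight b) (hp : p ≠ ⊤) {u : Plane → E}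
    (hu : MemLp u p volume) : ContinuousOn (fun γ => lpClass p (A.pull b u γ)) A.G := by
  have key : ∀ i : ℕ, ∃ v : Plane → E, HasCompactSupport v ∧ ContDiff ℝ ∞ v ∧
      eLpNorm (u - v) p volume ≤ ENNReal.ofReal (1 / ((i : ℝ) + 1)) := fun i =>
    hu.exist_eLpNorm_sub_le hp hp1.out (by positivity)
  choose v hc hs hle using key
  have h0 : Tendsto (fun i => eLpNorm (v i - u) p volume) atTop (𝓝 0) := by
    refine tendsto_of_tendsto_of_tendsto_of_le_of_le tendsto_const_nhds (h := fun i : ℕ =>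
      ENNReal.ofReal (1 / ((i : ℝ) + 1))) ?_ (fun i => zero_le) fun i => ?_
    · simpa using ENNReal.tendsto_ofReal tendsto_one_div_add_atTop_nhds_zero_nat
    · rw [eLpNorm_sub_comm]
      exact hle i
  refine (hb.tendstoLocallyUniformlyOn hp hu
    (fun i => (hs i).continuous.memLp_of_hasCompactSupport (hc i)) h0).continuousOn
    (.of_forall fun i γ hγ => ?_)
  exact (hb.hasFDerivAt_pull_of_contDiff hp (hs i) hγ).continuousAt.continuousWithinAt

theorem IsWeight.contDiffOn_lpClass_pull (hp : p ≠ ⊤) (m : ℕ) :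
    ∀ {b : EuclideanSpace ℝ (Fin n) × Plane → ℝ}, A.IsWeight b → ∀ {u : Plane → E},
      MemPlaneSobolev m p u → ContDiffOn ℝ m (fun γ => lpClass p (A.pull b u γ)) A.G := by
  induction m with
  | zero =>
    intro b hb u hu
    simpa using hb.continuousOn_pull hp hu.1
  | succ m ih =>
    intro b hb u hu
    obtain ⟨g, hg⟩ := hu.exists_hasWeakDeriv
    refine contDiffOn_succ_of_hasFDerivAt A.isOpen_G (fun γ hγ =>
      hb.hasFDerivAt_pull hp hu.1 (fun q => (hg q).1.1) (fun q => (hg q).2) hγ) ?_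
    refine ContDiffOn.sum fun i _ => ?_
    refine (ContinuousLinearMap.smulRightL ℝ (EuclideanSpace ℝ (Fin n)) (Lp E p volume)
      (EuclideanSpace.proj i)).contDiff.comp_contDiffOn ?_
    refine ContDiffOn.congr ?_ fun γ hγ =>
      hb.lpClass_pullDir hp hγ hu.1 (fun q => (hg q).1.1) (EuclideanSpace.single i 1, 0)
    have h1 := ih (hb.fderiv_apply (EuclideanSpace.single i 1, 0)) (hu.mono (Nat.le_succ m))
    have h2 := fun q => ih (hb.mul_fderiv_apply (EuclideanSpace.single i 1, 0) q) (hg q).1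
    have h3 := ContDiffOn.sum (s := Finset.univ) fun q _ => h2 q
    exact ContDiffOn.add h1 h3

/-- For `u` in `W^{k,p}` with `k = j + m`, the weak derivatives of order `j` of the weighted
compositions of `u` form a curve of class `C^m` in `L^p`. -/
theorem IsWeight.exists_contDiffOn_hasWeakPartial (hp : p ≠ ⊤) (m j : ℕ) :
    ∀ (w : Fin j → Fin 2) {b : EuclideanSpace ℝ (Fin n) × Plane → ℝ}, A.IsWeight b →
      ∀ {u : Plane → E}, MemPlaneSobolev (j + m) p u →
        ∃ h : EuclideanSpace ℝ (Fin n) → Lp E p (volume : Measure Plane),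
          ContDiffOn ℝ m h A.G ∧ ∀ γ ∈ A.G, HasWeakPartial w (A.pull b u γ) (h γ) := by
  induction j with
  | zero =>
    intro w b hb u hu
    rw [zero_add] at hu
    exact ⟨_, hb.contDiffOn_lpClass_pull hp m hu, fun γ hγ =>
      (hasWeakPartial_zero w _).congr_right (coeFn_lpClass (hb.memLp_pull hp hγ hu.1)).symm⟩
  | succ j ih =>
    intro w b hb u hu
    obtain ⟨g, hg⟩ := MemPlaneSobolev.exists_hasWeakDeriv (k := j + m) (by
      rwa [add_right_comm] at hu)
    set e : EuclideanSpace ℝ (Fin n) × Plane := (0, EuclideanSpace.single (w 0) 1)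
    obtain ⟨h₀, hs₀, hw₀⟩ := ih (Fin.tail w) (hb.fderiv_apply e)
      (hu.mono (by omega : j + m ≤ j + 1 + m))
    have key := fun q => ih (Fin.tail w) (hb.mul_fderiv_apply e q) (hg q).1
    choose h₁ hs₁ hw₁ using key
    refine ⟨fun γ => h₀ γ + (h₁ 0 γ + h₁ 1 γ), hs₀.add ((hs₁ 0).add (hs₁ 1)), fun γ hγ => ?_⟩
    rw [← Fin.cons_self_tail w]
    refine (hb.hasWeakDeriv_pull hp hu.1 (fun q => (hg q).1.1) (fun q => (hg q).2) hγ
      (w 0)).hasWeakPartial_cons_iff.2 ?_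
    have m₀ := (hb.fderiv_apply e).memLp_pull hp hγ hu.1
    have m₁ := fun q => (hb.mul_fderiv_apply e q).memLp_pull hp hγ (hg q).1.1
    rw [pullDir, Fin.sum_univ_two]
    have h2 := (hw₁ 0 γ hγ).add hp1.out (m₁ 0) (Lp.memLp (h₁ 0 γ)) (m₁ 1)
      (Lp.memLp (h₁ 1 γ)) (hw₁ 1 γ hγ)
    have h3 := (hw₀ γ hγ).add hp1.out m₀ (Lp.memLp (h₀ γ)) ((m₁ 0).add (m₁ 1))
      ((Lp.memLp (h₁ 0 γ)).add (Lp.memLp (h₁ 1 γ))) h2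
    refine h3.congr_right ?_
    filter_upwards [Lp.coeFn_add (h₀ γ) (h₁ 0 γ + h₁ 1 γ), Lp.coeFn_add (h₁ 0 γ) (h₁ 1 γ)]
      with x hx hx'
    rw [hx, Pi.add_apply, Pi.add_apply, Pi.add_apply, hx', Pi.add_apply]

end PlaneFamily

/-! ### Completeness of the Sobolev spaces -/

section Completeness

variable {M : Type*} [TopologicalSpace M] [ChartedSpace Plane M] [MeasurableSpace M] [BorelSpace M]
  {D : SobolevAtlas M} {E : Type*} [NormedAddCommGroup E] [NormedSpace ℝ E]

theorem SobolevAtlas.ae_chart_of_ae_measure {P : M → Prop} (h : ∀ᵐ y ∂D.measure, P y)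
    (i : Fin D.card) : ∀ᵐ x, x ∈ (D.chart i).target →
      D.weight i ((D.chart i).symm x) ≠ 0 → P ((D.chart i).symm x) := by
  have h1 := (ae_withDensity_iff (measurable_weight D i)).1 ((Measure.ae_sum_iff.1 h) i)
  filter_upwards [(ae_restrict_iff' (D.chart i).open_target.measurableSet).1
    (ae_of_ae_map (aemeasurable_chart_symm D i) h1)] with x hx hxt h0
  have hpos : 0 < D.weight i ((D.chart i).symm x) :=
    lt_of_le_of_ne (D.weight.nonneg i _) (Ne.symm h0)
  exact hx hxt (ENNReal.ofReal_pos.2 hpos).ne'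

theorem SobolevAtlas.ae_measure_of_ae_chart {P : M → Prop} (hP : MeasurableSet {y | P y})
    (h : ∀ i, ∀ᵐ x, x ∈ (D.chart i).target →
      D.weight i ((D.chart i).symm x) ≠ 0 → P ((D.chart i).symm x)) : ∀ᵐ y ∂D.measure, P y := by
  refine Measure.ae_sum_iff.2 fun i => (ae_withDensity_iff (measurable_weight D i)).2 ?_
  have hm : MeasurableSet {y | ENNReal.ofReal (D.weight i y) ≠ 0 → P y} := by
    have h1 : MeasurableSet {y | ENNReal.ofReal (D.weight i y) = 0} :=
      measurable_weight D i (measurableSet_singleton 0)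
    convert h1.union hP using 1
    ext y
    simp only [mem_ofPred_eq, mem_union]
    tauto
  rw [ae_map_iff (aemeasurable_chart_symm D i) hm,
    ae_restrict_iff' (D.chart i).open_target.measurableSet]
  filter_upwards [h i] with x hx hxt hne
  exact hx hxt fun h0 => hne (by simp [h0])

theorem ae_eq_of_localRep {u v : M → E} (hu : StronglyMeasurable u) (hv : StronglyMeasurable v)
    (h : ∀ i, D.localRep i u =ᵐ[volume] D.localRep i v) : u =ᵐ[D.measure] v := by
  have key : ∀ i, D.localRep i (u - v) =ᵐ[volume] 0 := fun i => by
    have e : D.localRep i (u - v) = D.localRep i u - D.localRep i v := by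
      rw [sub_eq_add_neg, ← neg_one_smul ℝ v, localRep_add, localRep_smul,
        neg_one_smul, sub_eq_add_neg]
    rw [e]
    filter_upwards [h i] with x hx
    simp [hx]
  filter_upwards [ae_eq_zero_of_localRep D (hu.sub hv) key] with y hy
  exact sub_eq_zero.1 hy

theorem measurableSet_exists_tendsto_of_stronglyMeasurable {α : Type*} [MeasurableSpace α]
    [CompleteSpace E] {f : ℕ → α → E} (hf : ∀ n, StronglyMeasurable (f n)) :
    MeasurableSet {y | ∃ l, Tendsto (fun n => f n y) atTop (𝓝 l)} := by
  have e : {y | ∃ l, Tendsto (fun n => f n y) atTop (𝓝 l)} = ⋂ k : ℕ, ⋃ N : ℕ, ⋂ n : ℕ,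
      {y | N ≤ n → dist (f n y) (f N y) < 1 / ((k : ℝ) + 1)} := by
    ext y
    simp only [mem_ofPred_eq, mem_iInter, mem_iUnion]
    constructor
    · rintro ⟨l, hl⟩ k
      obtain ⟨N, hN⟩ := Metric.cauchySeq_iff'.1 hl.cauchySeq (1 / ((k : ℝ) + 1)) (by positivity)
      exact ⟨N, fun n hn => hN n hn⟩
    · intro h
      refine cauchySeq_tendsto_of_complete (Metric.cauchySeq_iff'.2 fun ε hε => ?_)
      obtain ⟨k, hk⟩ := exists_nat_one_div_lt hε
      obtain ⟨N, hN⟩ := h k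
      exact ⟨N, fun n hn => (hN n hn).trans hk⟩
  rw [e]
  refine MeasurableSet.iInter fun k => .iUnion fun N => .iInter fun n => ?_
  by_cases hn : N ≤ n
  · simp only [hn, forall_const]
    exact measurableSet_lt ((hf n).dist (hf N)).measurable measurable_const
  · simp [hn]

variable {p : ℝ≥0∞} [hp1 : Fact (1 ≤ p)] {k : ℕ}

theorem lpClass_coeFn (f : Lp E p (volume : Measure Plane)) : lpClass p f = f := by
  rw [(Lp.memLp f).lpClass_eq, Lp.toLp_coeFn]

namespace SobolevSpace

variable [CompleteSpace E]

variable (D E k p) in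
/-- The jet map as a linear isometry. -/
noncomputable def jetₗᵢ : SobolevSpace D E k p →ₗᵢ[ℝ]
    PiLp p fun _ : Fin D.card × Word k => Lp E p (volume : Measure Plane) where
  toLinearMap := jet D E k p
  norm_map' _ := rfl

theorem edist_partialLp_le (u v : SobolevSpace D E k p) (a : Fin D.card × Word k) :
    edist (u.partialLp a) (v.partialLp a) ≤ edist u v := by
  rw [← (jetₗᵢ D E p k).isometry u v]
  exact PiLp.edist_apply_le (jet D E k p u) (jet D E k p v) a

variable (k) in
/-- The empty word, which stands for the derivative of order zero. -/
def emptyWord : Word k := ⟨⟨0, Nat.succ_pos k⟩, Fin.elim0⟩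

theorem partialLp_emptyWord (u : SobolevSpace D E k p) (i : Fin D.card) :
    u.partialLp (i, emptyWord k) = lpClass p (D.localRep i u) :=
  Lp.ext ((u.partialLp_eq (i, emptyWord k) (u.mem i).1 (hasWeakPartial_zero _ _)).trans
    (coeFn_lpClass (u.mem i).1).symm)

theorem edist_lpClass_localRep_le (u v : SobolevSpace D E k p) (i : Fin D.card) :
    edist (lpClass p (D.localRep i u)) (lpClass p (D.localRep i v)) ≤ edist u v := by
  rw [← partialLp_emptyWord, ← partialLp_emptyWord]
  exact edist_partialLp_le u v _

theorem eq_of_ae_eq {u v : SobolevSpace D E k p} (h : (u : M → E) =ᵐ[D.measure] v) : u = v :=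
  Subtype.ext (AEEqFun.ext h)

theorem eq_of_lpClass_localRep {u v : SobolevSpace D E k p}
    (h : ∀ i, lpClass p (D.localRep i u) = lpClass p (D.localRep i v)) : u = v :=
  eq_of_ae_eq <| ae_eq_of_localRep u.toAEEqFun.stronglyMeasurable v.toAEEqFun.stronglyMeasurable
    fun i => (coeFn_lpClass (u.mem i).1).symm.trans
      ((Lp.ext_iff.1 (h i)).trans (coeFn_lpClass (v.mem i).1))

theorem tendsto_eLpNorm_localRep {u : ℕ → SobolevSpace D E k p} {v : SobolevSpace D E k p}
    (h : Tendsto u atTop (𝓝 v)) (i : Fin D.card) :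
    Tendsto (fun n => eLpNorm (D.localRep i (u n) - D.localRep i v) p volume) atTop (𝓝 0) := by
  refine tendsto_of_tendsto_of_tendsto_of_le_of_le tendsto_const_nhds
    (tendsto_iff_edist_tendsto_0.1 h) (fun _ => zero_le) fun n => ?_
  simp only
  rw [← enorm_lpClass (((u n).mem i).1.sub (v.mem i).1),
    lpClass_sub ((u n).mem i).1 (v.mem i).1, ← edist_eq_enorm_sub]
  exact edist_lpClass_localRep_le _ _ i

/-- The Sobolev spaces are complete. A rapidly convergent Cauchy sequence has localizations that
converge almost everywhere in the charts, hence it converges almost everywhere on `M`; the weak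
derivatives pass to the limit. -/
instance : CompleteSpace (SobolevSpace D E k p) := by
  refine EMetric.complete_of_convergent_controlled_sequences (fun N => (2⁻¹ : ℝ≥0∞) ^ N)
    (fun N => ENNReal.pow_pos (by simp) N) fun u hu => ?_
  have hB : ∑' N : ℕ, (2⁻¹ : ℝ≥0∞) ^ N ≠ ⊤ := by
    rw [ENNReal.tsum_geometric, ENNReal.one_sub_inv_two, inv_inv]
    exact ENNReal.ofNat_ne_top
  have hcauchy : CauchySeq u := by
    refine EMetric.cauchySeq_iff.2 fun ε hε => ?_
    obtain ⟨N, hN⟩ := ((ENNReal.tendsto_pow_atTop_nhds_zero_of_lt_one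
      (ENNReal.inv_lt_one.2 ENNReal.one_lt_two)).eventually (gt_mem_nhds hε)).exists
    exact ⟨N, fun m hm n hn => (hu N m n hm hn).trans hN⟩
  have hG : ∀ a, ∃ g, Tendsto (fun n => (u n).partialLp a) atTop (𝓝 g) := fun a => by
    refine cauchySeq_tendsto_of_complete (EMetric.cauchySeq_iff.2 fun ε hε => ?_)
    obtain ⟨N, hN⟩ := EMetric.cauchySeq_iff.1 hcauchy ε hε
    exact ⟨N, fun m hm n hn => (edist_partialLp_le _ _ a).trans_lt (hN m hm n hn)⟩
  choose g hg using hG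
  have hloc : ∀ i N n m, N ≤ n → N ≤ m →
      eLpNorm (D.localRep i (u n) - D.localRep i (u m)) p volume < (2⁻¹ : ℝ≥0∞) ^ N := by
    intro i N n m hn hm
    rw [← enorm_lpClass (((u n).mem i).1.sub ((u m).mem i).1),
      lpClass_sub ((u n).mem i).1 ((u m).mem i).1, ← edist_eq_enorm_sub]
    exact (edist_lpClass_localRep_le _ _ i).trans_lt (hu N n m hn hm)
  have hconv : ∀ᵐ y ∂D.measure, ∃ l, Tendsto (fun n => u n y) atTop (𝓝 l) := by
    refine SobolevAtlas.ae_measure_of_ae_chart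
      (measurableSet_exists_tendsto_of_stronglyMeasurable
        fun n => (u n).toAEEqFun.stronglyMeasurable) fun i => ?_
    filter_upwards [Lp.ae_tendsto_of_cauchy_eLpNorm (fun n => ((u n).mem i).1.1) hp1.out hB
      (hloc i)] with x hx hxt h0
    obtain ⟨l, hl⟩ := hx
    refine ⟨(D.weight i ((D.chart i).symm x))⁻¹ • l, ?_⟩
    refine (hl.const_smul (D.weight i ((D.chart i).symm x))⁻¹).congr fun n => ?_
    simp only [SobolevAtlas.localRep, hxt, indicator_of_mem]
    exact inv_smul_smul₀ h0 _
  obtain ⟨f, hf, hlim⟩ := exists_stronglyMeasurable_limit_of_tendsto_ae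
    (fun n => (u n).toAEEqFun.aestronglyMeasurable) hconv
  have hloclim : ∀ i, ∀ᵐ x, Tendsto (fun n => D.localRep i (u n) x) atTop
      (𝓝 (D.localRep i f x)) := fun i => by
    filter_upwards [SobolevAtlas.ae_chart_of_ae_measure hlim i] with x hx
    by_cases hxt : x ∈ (D.chart i).target
    · simp only [SobolevAtlas.localRep, hxt, indicator_of_mem]
      by_cases h0 : D.weight i ((D.chart i).symm x) = 0
      · simp [h0]
      · exact (hx hxt h0).const_smul _
    · simp [SobolevAtlas.localRep, hxt]
  have hnorm : ∀ i, Tendsto (fun n => eLpNorm (D.localRep i (u n) - D.localRep i f) p volume)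
      atTop (𝓝 0) := fun i =>
    Lp.cauchy_tendsto_of_tendsto (fun n => ((u n).mem i).1.1) _ hB (hloc i) (hloclim i)
  have hmem : ∀ i, MemLp (D.localRep i f) p volume := fun i =>
    Lp.memLp_of_cauchy_tendsto hp1.out (fun n => ((u n).mem i).1) _
      (aestronglyMeasurable_of_tendsto_ae atTop (fun n => ((u n).mem i).1.1) (hloclim i)) (hnorm i)
  have hweak : ∀ a : Fin D.card × Word k, HasWeakPartial a.2.2 (D.localRep a.1 f) (g a) :=
    fun a => HasWeakPartial.of_tendsto (l := atTop) (fun n => ((u n).mem a.1).1) (hmem a.1)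
      (fun n => Lp.memLp ((u n).partialLp a)) (Lp.memLp _)
      (tendsto_lpClass (fun n => ((u n).mem a.1).1) (hmem a.1) (hnorm a.1))
      (by simpa only [lpClass_coeFn] using hg a) (fun n => (u n).partialLp_spec a)
  have hff : f =ᵐ[D.measure] AEEqFun.mk f hf.aestronglyMeasurable := (AEEqFun.coeFn_mk _ _).symm
  let U : SobolevSpace D E k p := ⟨AEEqFun.mk f hf.aestronglyMeasurable, fun i =>
    MemPlaneSobolev.congr ⟨hmem i, fun j hj w =>
      ⟨g (i, ⟨⟨j, Nat.lt_succ_of_le hj⟩, w⟩), Lp.memLp _,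
        hweak (i, ⟨⟨j, Nat.lt_succ_of_le hj⟩, w⟩)⟩⟩
      (localRep_congr D i hff)⟩
  have hU : ∀ a, U.partialLp a = g a := fun a => Lp.ext <|
    U.partialLp_eq a (Lp.memLp _) ((hweak a).congr (localRep_congr D a.1 hff))
  refine ⟨U, (jetₗᵢ D E p k).isometry.isEmbedding.tendsto_nhds_iff.2 ?_⟩
  refine ((PiLp.continuous_toLp p _).tendsto _).comp (tendsto_pi_nhds.2 fun a => ?_)
  rw [hU a]
  exact hg a

end SobolevSpace

end Completeness

/-! ### Families of diffeomorphisms in charts -/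

section Transitions

variable {M : Type*} [TopologicalSpace M] [CompactSpace M] [T2Space M] [ChartedSpace Plane M]
  [IsManifold (𝓡 2) ∞ M] {D : SobolevAtlas M} {n : ℕ}
  {G : Set (EuclideanSpace ℝ (Fin n))} {φ : EuclideanSpace ℝ (Fin n) → M → M}

/-- A smooth cutoff function supported in the domain of the `j`-th chart that equals one on the
support of `ρ_j`. -/
theorem SobolevAtlas.exists_cutoff (D : SobolevAtlas M) (j : Fin D.card) :
    ∃ χ : M → ℝ, ContMDiff (𝓡 2) 𝓘(ℝ) ∞ χ ∧ tsupport χ ⊆ (D.chart j).source ∧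
      ∀ y, D.weight j y ≠ 0 → χ y = 1 := by
  obtain ⟨V, hVo, hV, hVs⟩ := normal_exists_closure_subset (isClosed_tsupport (D.weight j))
    (D.chart j).open_source (D.subordinate j)
  obtain ⟨χ, h0, h1, -⟩ := exists_contMDiffMap_zero_one_of_isClosed (𝓡 2) (n := ⊤)
    hVo.isClosed_compl (isClosed_tsupport (D.weight j)) (disjoint_compl_left_iff_subset.2 hV)
  refine ⟨χ, χ.contMDiff, (closure_mono fun y hy => ?_).trans hVs,
    fun y hy => h1 (subset_tsupport _ hy)⟩
  by_contra hyV
  exact hy (h0 hyV)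

theorem contMDiffOn_comp_chart_symm
    (hφ : ContMDiffOn ((𝓡 n).prod (𝓡 2)) (𝓡 2) ∞
      (fun z : EuclideanSpace ℝ (Fin n) × M => φ z.1 z.2) (G ×ˢ univ)) (i : Fin D.card) :
    ContMDiffOn 𝓘(ℝ, EuclideanSpace ℝ (Fin n) × Plane) (𝓡 2) ∞
      (fun z : EuclideanSpace ℝ (Fin n) × Plane => φ z.1 ((D.chart i).symm z.2))
      (G ×ˢ (D.chart i).target) := by
  have h1 : ContMDiffOn 𝓘(ℝ, EuclideanSpace ℝ (Fin n) × Plane) (𝓡 2) ∞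
      (fun z : EuclideanSpace ℝ (Fin n) × Plane => (D.chart i).symm z.2)
      (G ×ˢ (D.chart i).target) :=
    (contMDiffOn_symm_of_mem_maximalAtlas (D.chart_mem i)).comp
      (contDiff_snd.contMDiff.contMDiffOn) fun z hz => hz.2
  have h2 : ContMDiffOn 𝓘(ℝ, EuclideanSpace ℝ (Fin n) × Plane) (𝓡 n) ∞
      (fun z : EuclideanSpace ℝ (Fin n) × Plane => z.1) (G ×ˢ (D.chart i).target) :=
    contDiff_fst.contMDiff.contMDiffOn
  exact hφ.comp (h2.prodMk h1) fun z hz => ⟨hz.1, mem_univ _⟩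

/-- The derivative of a diffeomorphism, read in charts, is invertible. -/
theorem det_ne_zero_of_diffeomorph (ψ : M ≃ₘ⟮𝓡 2, 𝓡 2⟯ M) (i j : Fin D.card) {x : Plane}
    (hx : x ∈ (D.chart i).target) (hxj : ψ ((D.chart i).symm x) ∈ (D.chart j).source)
    {B : Plane →L[ℝ] Plane}
    (hB : HasFDerivAt (fun x => D.chart j (ψ ((D.chart i).symm x))) B x) : B.det ≠ 0 := by
  set y := D.chart j (ψ ((D.chart i).symm x)) with hy
  have hyt : y ∈ (D.chart j).target := (D.chart j).map_source hxj
  have hys : (D.chart j).symm y = ψ ((D.chart i).symm x) := (D.chart j).left_inv hxj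
  have hinv : ContMDiffAt (𝓡 2) (𝓡 2) ∞
      (fun y => D.chart i (ψ.symm ((D.chart j).symm y))) y := by
    have h1 := (contMDiffOn_symm_of_mem_maximalAtlas (D.chart_mem j)).contMDiffAt
      ((D.chart j).open_target.mem_nhds hyt)
    have hz : ψ.symm ((D.chart j).symm y) ∈ (D.chart i).source := by
      rw [hys, ψ.symm_apply_apply]
      exact (D.chart i).map_target hx
    have h2 := (contMDiffOn_of_mem_maximalAtlas (D.chart_mem i)).contMDiffAt
      ((D.chart i).open_source.mem_nhds hz)
    exact ContMDiffAt.comp y h2 (ContMDiffAt.comp y ψ.symm.contMDiff.contMDiffAt h1)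
  have hinv' := ((contMDiffAt_iff_contDiffAt.1 hinv).differentiableAt (by simp)).hasFDerivAt
  have hcomp := hinv'.comp x hB
  have hid : ((fun y => D.chart i (ψ.symm ((D.chart j).symm y))) ∘
      fun x => D.chart j (ψ ((D.chart i).symm x))) =ᶠ[𝓝 x] id := by
    have hO : ∀ᶠ x' in 𝓝 x, x' ∈ (D.chart i).target ∧
        ψ ((D.chart i).symm x') ∈ (D.chart j).source := by
      refine ((D.chart i).open_target.eventually_mem hx).and ?_
      have hc : ContinuousAt (fun x => ψ ((D.chart i).symm x)) x :=
        ψ.continuous.continuousAt.comp ((D.chart i).continuousAt_symm hx)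
      exact hc.eventually ((D.chart j).open_source.mem_nhds hxj)
    filter_upwards [hO] with x' hx'
    simp only [Function.comp_apply, id]
    rw [(D.chart j).left_inv hx'.2, ψ.symm_apply_apply, (D.chart i).right_inv hx'.1]
  have hone := (hcomp.congr_of_eventuallyEq hid.symm).unique (hasFDerivAt_id x)
  intro h0
  have h1 : LinearMap.det ((fderiv ℝ (fun y => D.chart i (ψ.symm ((D.chart j).symm y))) y :
      Plane →ₗ[ℝ] Plane) ∘ₗ (B : Plane →ₗ[ℝ] Plane)) = 1 :=
    (congrArg (fun T : Plane →L[ℝ] Plane => LinearMap.det (T : Plane →ₗ[ℝ] Plane)) hone).trans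
      LinearMap.det_id
  rw [LinearMap.det_comp, show LinearMap.det (B : Plane →ₗ[ℝ] Plane) = 0 from h0, mul_zero] at h1
  exact zero_ne_one h1

/-- Read in two charts, a smooth family of diffeomorphisms of `M` is a family on the plane for which
`ρ_i · χ_j ∘ φ_γ` is a weight; here `χ_j` is a cutoff function equal to one on the support of
`ρ_j`. -/
theorem exists_planeFamily {E : Type*} [NormedAddCommGroup E] [NormedSpace ℝ E] (hG : IsOpen G)
    (hφ : ContMDiffOn ((𝓡 n).prod (𝓡 2)) (𝓡 2) ∞
      (fun z : EuclideanSpace ℝ (Fin n) × M => φ z.1 z.2) (G ×ˢ univ))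
    (hd : ∀ γ ∈ G, ∃ ψ : M ≃ₘ⟮𝓡 2, 𝓡 2⟯ M, ⇑ψ = φ γ) (i j : Fin D.card) :
    ∃ (A : PlaneFamily n) (b : EuclideanSpace ℝ (Fin n) × Plane → ℝ), A.G = G ∧ A.IsWeight b ∧
      ∀ γ ∈ G, ∀ u : M → E, A.pull b (D.localRep j u) γ =
        D.localRep i fun y => D.weight j (φ γ y) • u (φ γ y) := by
  obtain ⟨χ, hχ, hχs, hχ1⟩ := D.exists_cutoff j
  set W : EuclideanSpace ℝ (Fin n) × Plane → M := fun z => φ z.1 ((D.chart i).symm z.2)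
  have hW := contMDiffOn_comp_chart_symm hφ i
  have hO : IsOpen (G ×ˢ (D.chart i).target) := hG.prod (D.chart i).open_target
  have hpre : ∀ V : Set M, IsOpen V →
      IsOpen {z | z ∈ G ×ˢ (D.chart i).target ∧ W z ∈ V} := fun V hV =>
    hW.continuousOn.isOpen_inter_preimage hO hV
  set L : Set Plane := D.chart i '' tsupport (D.weight i)
  have hLc : IsCompact L := (isClosed_tsupport _).isCompact.image_of_continuousOn
    ((D.chart i).continuousOn.mono (D.subordinate i))
  have hLt : L ⊆ (D.chart i).target := by
    rintro _ ⟨y, hy, rfl⟩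
    exact (D.chart i).map_source (D.subordinate i hy)
  have hψs : ContDiffOn ℝ ∞ (fun z => D.chart j (W z))
      {z | z ∈ G ×ˢ (D.chart i).target ∧ W z ∈ (D.chart j).source} := by
    rw [← contMDiffOn_iff_contDiffOn]
    exact (contMDiffOn_of_mem_maximalAtlas (D.chart_mem j)).comp (hW.mono fun z hz => hz.1)
      fun z hz => hz.2
  let A : PlaneFamily n :=
    { G := G
      isOpen_G := hG
      ψ := fun z => D.chart j (W z)
      Ω := {z | z ∈ G ×ˢ (D.chart i).target ∧ W z ∈ (D.chart j).source}
      isOpen_Ω := hpre _ (D.chart j).open_source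
      contDiffOn_ψ := hψs
      injOn_ψ := by
        rintro γ x ⟨⟨hγ, hx⟩, hxs⟩ x' ⟨⟨-, hx'⟩, hxs'⟩ he
        obtain ⟨ψ, hψ⟩ := hd γ hγ
        have h1 : φ γ ((D.chart i).symm x) = φ γ ((D.chart i).symm x') :=
          (D.chart j).injOn hxs hxs' he
        rw [← hψ] at h1
        exact (D.chart i).symm.injOn hx hx' (ψ.injective h1)
      det_ne_zero := by
        rintro z hz
        obtain ⟨ψ, hψ⟩ := hd z.1 hz.1.1
        have h1 := ((hψs.contDiffAt ((hpre _ (D.chart j).open_source).mem_nhds hz)).differentiableAt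
          (by simp)).hasFDerivAt
        have h2 := HasFDerivAt.comp (f := fun x => (z.1, x)) z.2 h1
          (hasFDerivAt_prodMk_right z.1 z.2)
        have h3 : W z ∈ (D.chart j).source := hz.2
        refine det_ne_zero_of_diffeomorph ψ i j hz.1.2 (by rw [hψ]; exact h3) ?_
        rw [hψ]
        exact h2
      S := {z | z ∈ G ×ˢ (D.chart i).target ∧ z.2 ∈ L ∧ W z ∈ tsupport χ}
      S_subset := fun z hz => ⟨hz.1, hχs hz.2.2⟩
      isOpen_diff := by
        convert (hG.prod hLc.isClosed.isOpen_compl).union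
          (hpre _ (isClosed_tsupport χ).isOpen_compl) using 1
        ext z
        by_cases h1 : z.1 ∈ G
        · by_cases h2 : z.2 ∈ L
          · simp [h1, h2, hLt h2]
          · simp [h1, h2]
        · simp [h1]
      L := L
      isCompact_L := hLc
      snd_mem_L := fun z hz => hz.2.1 }
  let b : EuclideanSpace ℝ (Fin n) × Plane → ℝ := fun z =>
    (D.chart i).target.indicator (fun x => D.weight i ((D.chart i).symm x)) z.2 * χ (W z)
  -- `ρ_i` in the chart `i`, extended by zero, vanishes outside the compact set `L`
  have hzero : ∀ x ∉ L,
      (D.chart i).target.indicator (fun x => D.weight i ((D.chart i).symm x)) x = 0 := by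
    intro x hx
    by_cases hxt : x ∈ (D.chart i).target
    · rw [indicator_of_mem hxt]
      by_contra h0
      exact hx ⟨_, subset_tsupport _ h0, (D.chart i).right_inv hxt⟩
    · exact indicator_of_notMem hxt _
  refine ⟨A, b, rfl, ⟨fun z hz => ContDiffAt.contDiffWithinAt ?_, fun z hz hS => ?_⟩,
    fun γ hγ u => funext fun x => ?_⟩
  · by_cases hzt : z.2 ∈ (D.chart i).target
    · have hρ : ContMDiffOn 𝓘(ℝ, EuclideanSpace ℝ (Fin n) × Plane) 𝓘(ℝ) ∞
          (fun z : EuclideanSpace ℝ (Fin n) × Plane => D.weight i ((D.chart i).symm z.2))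
          (G ×ˢ (D.chart i).target) :=
        (D.weight i).contMDiff.comp_contMDiffOn
          ((contMDiffOn_symm_of_mem_maximalAtlas (D.chart_mem i)).comp
            (contDiff_snd.contMDiff.contMDiffOn) fun z hz => hz.2)
      have hχW := hχ.comp_contMDiffOn hW
      have h1 : ContDiffOn ℝ ∞ (fun z : EuclideanSpace ℝ (Fin n) × Plane =>
          D.weight i ((D.chart i).symm z.2) * χ (W z)) (G ×ˢ (D.chart i).target) :=
        (contMDiffOn_iff_contDiffOn.1 hρ).mul (contMDiffOn_iff_contDiffOn.1 hχW)
      have hnhds := hO.mem_nhds (⟨hz.1, hzt⟩ : z ∈ G ×ˢ (D.chart i).target)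
      refine (h1.contDiffAt hnhds).congr_of_eventuallyEq ?_
      filter_upwards [hnhds] with z' hz'
      simp only [b, indicator_of_mem hz'.2]
    · refine (contDiffAt_const (c := (0 : ℝ))).congr_of_eventuallyEq ?_
      have hnhds := (isOpen_univ.prod hLc.isClosed.isOpen_compl).mem_nhds
        (⟨mem_univ z.1, fun h => hzt (hLt h)⟩ : z ∈ univ ×ˢ Lᶜ)
      filter_upwards [hnhds] with z' hz'
      simp only [b, hzero _ hz'.2, zero_mul]
  · by_cases hzL : z.2 ∈ L
    · have hχ0 : χ (W z) = 0 := by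
        by_contra h0
        exact hS ⟨⟨hz.1, hLt hzL⟩, hzL, subset_tsupport _ h0⟩
      simp only [b, hχ0, mul_zero]
    · simp only [b, hzero _ hzL, zero_mul]
  · by_cases hx : x ∈ (D.chart i).target
    · simp only [PlaneFamily.pull, b, A, W, SobolevAtlas.localRep, hx, indicator_of_mem]
      by_cases hs : φ γ ((D.chart i).symm x) ∈ (D.chart j).source
      · rw [indicator_of_mem ((D.chart j).map_source hs), (D.chart j).left_inv hs]
        by_cases h0 : D.weight j (φ γ ((D.chart i).symm x)) = 0
        · simp [h0]
        · rw [hχ1 _ h0, mul_one]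
      · have h0 : D.weight j (φ γ ((D.chart i).symm x)) = 0 := by
          by_contra h0
          exact hs (D.subordinate j (subset_tsupport _ h0))
        have h1 : χ (φ γ ((D.chart i).symm x)) = 0 := by
          by_contra h1
          exact hs (hχs (subset_tsupport _ h1))
        simp [h0, h1]
    · simp [PlaneFamily.pull, b, SobolevAtlas.localRep, hx]

end Transitions

/-! ### The action map -/

section Action

variable {M : Type*} [TopologicalSpace M] [CompactSpace M] [T2Space M] [ChartedSpace Plane M]
  [IsManifold (𝓡 2) ∞ M] {D : SobolevAtlas M} {n : ℕ}
  {G : Set (EuclideanSpace ℝ (Fin n))} {φ : EuclideanSpace ℝ (Fin n) → M → M}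
  {E : Type*} [NormedAddCommGroup E] [NormedSpace ℝ E] {p : ℝ≥0∞} [hp1 : Fact (1 ≤ p)]

theorem SobolevAtlas.localRep_eq_sum (D : SobolevAtlas M) (i : Fin D.card) (f : M → M)
    (u : M → E) : D.localRep i (fun y => u (f y)) =
      ∑ j, D.localRep i fun y => D.weight j (f y) • u (f y) := by
  have h1 : ∀ z, ∑ j, D.weight j z = 1 := fun z => by
    rw [← finsum_eq_sum_of_fintype]
    exact D.weight.sum_eq_one (mem_univ z)
  funext x
  rw [Finset.sum_apply]
  by_cases hx : x ∈ (D.chart i).target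
  · simp only [SobolevAtlas.localRep, hx, indicator_of_mem]
    rw [← Finset.smul_sum, ← Finset.sum_smul, h1, one_smul]
  · simp [SobolevAtlas.localRep, hx]

/-- In charts, composition with `φ_γ` is a finite sum of weighted compositions on the plane. -/
theorem exists_planeFamily_sum (hG : IsOpen G)
    (hφ : ContMDiffOn ((𝓡 n).prod (𝓡 2)) (𝓡 2) ∞
      (fun z : EuclideanSpace ℝ (Fin n) × M => φ z.1 z.2) (G ×ˢ univ))
    (hd : ∀ γ ∈ G, ∃ ψ : M ≃ₘ⟮𝓡 2, 𝓡 2⟯ M, ⇑ψ = φ γ) (i : Fin D.card) :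
    ∃ (A : Fin D.card → PlaneFamily n) (b : Fin D.card → EuclideanSpace ℝ (Fin n) × Plane → ℝ),
      (∀ j, (A j).G = G) ∧ (∀ j, (A j).IsWeight (b j)) ∧ ∀ γ ∈ G, ∀ u : M → E,
        D.localRep i (fun y => u (φ γ y)) = ∑ j, (A j).pull (b j) (D.localRep j u) γ := by
  choose A b hA hb h using exists_planeFamily (E := E) hG hφ hd i
  refine ⟨A, b, hA, hb, fun γ hγ u => ?_⟩
  rw [D.localRep_eq_sum i (φ γ) u]
  exact Finset.sum_congr rfl fun j _ => (h j γ hγ u).symm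

theorem HasWeakPartial.sum {ι : Type*} (s : Finset ι) {j : ℕ} {w : Fin j → Fin 2}
    {u : ι → Plane → E} {g : ι → Lp E p (volume : Measure Plane)} (hu : ∀ i, MemLp (u i) p volume)
    (h : ∀ i, HasWeakPartial w (u i) (g i)) :
    HasWeakPartial w (∑ i ∈ s, u i) (∑ i ∈ s, g i : Lp E p (volume : Measure Plane)) := by
  classical
  induction s using Finset.induction_on with
  | empty =>
    refine HasWeakPartial.congr_right (g := 0) (fun θ _ _ => by simp) ?_
    exact (Lp.coeFn_zero E p volume).symm
  | insert i s hi ih =>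
    rw [Finset.sum_insert hi, Finset.sum_insert hi]
    exact ((h i).add hp1.out (hu i) (Lp.memLp _) (memLp_finsetSum' s fun i _ => hu i)
      (Lp.memLp _) ih).congr_right (Lp.coeFn_add _ _).symm

theorem memLp_localRep_comp (hp : p ≠ ⊤) (hG : IsOpen G)
    (hφ : ContMDiffOn ((𝓡 n).prod (𝓡 2)) (𝓡 2) ∞
      (fun z : EuclideanSpace ℝ (Fin n) × M => φ z.1 z.2) (G ×ˢ univ))
    (hd : ∀ γ ∈ G, ∃ ψ : M ≃ₘ⟮𝓡 2, 𝓡 2⟯ M, ⇑ψ = φ γ) {γ : EuclideanSpace ℝ (Fin n)} (hγ : γ ∈ G)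
    {u : M → E} (hu : ∀ j, MemLp (D.localRep j u) p volume) (i : Fin D.card) :
    MemLp (D.localRep i fun y => u (φ γ y)) p volume := by
  obtain ⟨A, b, hA, hb, h⟩ := exists_planeFamily_sum (E := E) hG hφ hd i
  rw [h γ hγ u]
  exact memLp_finsetSum' _ fun j _ => (hb j).memLp_pull hp (by rwa [hA j]) (hu j)

theorem localRep_comp_congr (hG : IsOpen G)
    (hφ : ContMDiffOn ((𝓡 n).prod (𝓡 2)) (𝓡 2) ∞
      (fun z : EuclideanSpace ℝ (Fin n) × M => φ z.1 z.2) (G ×ˢ univ))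
    (hd : ∀ γ ∈ G, ∃ ψ : M ≃ₘ⟮𝓡 2, 𝓡 2⟯ M, ⇑ψ = φ γ) {γ : EuclideanSpace ℝ (Fin n)} (hγ : γ ∈ G)
    {u v : M → E} (huv : ∀ j, D.localRep j u =ᵐ[volume] D.localRep j v) (i : Fin D.card) :
    (D.localRep i fun y => u (φ γ y)) =ᵐ[volume] D.localRep i fun y => v (φ γ y) := by
  obtain ⟨A, b, hA, hb, h⟩ := exists_planeFamily_sum (E := E) hG hφ hd i
  rw [h γ hγ u, h γ hγ v]
  filter_upwards [ae_all_iff.2 fun j => (hb j).pull_congr (γ := γ) (by rwa [hA j]) (huv j)]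
    with x hx
  rw [Finset.sum_apply, Finset.sum_apply]
  exact Finset.sum_congr rfl fun j _ => hx j

theorem tendsto_lpClass_localRep_comp (hp : p ≠ ⊤) (hG : IsOpen G)
    (hφ : ContMDiffOn ((𝓡 n).prod (𝓡 2)) (𝓡 2) ∞
      (fun z : EuclideanSpace ℝ (Fin n) × M => φ z.1 z.2) (G ×ˢ univ))
    (hd : ∀ γ ∈ G, ∃ ψ : M ≃ₘ⟮𝓡 2, 𝓡 2⟯ M, ⇑ψ = φ γ) {γ : EuclideanSpace ℝ (Fin n)} (hγ : γ ∈ G)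
    {u : M → E} (hu : ∀ j, MemLp (D.localRep j u) p volume) {v : ℕ → M → E}
    (hv : ∀ l j, MemLp (D.localRep j (v l)) p volume)
    (huv : ∀ j, Tendsto (fun l => eLpNorm (D.localRep j (v l) - D.localRep j u) p volume)
      atTop (𝓝 0)) (i : Fin D.card) :
    Tendsto (fun l => lpClass p (D.localRep i fun y => v l (φ γ y))) atTop
      (𝓝 (lpClass p (D.localRep i fun y => u (φ γ y)))) := by
  obtain ⟨A, b, hA, hb, h⟩ := exists_planeFamily_sum (E := E) hG hφ hd i
  have hγA : ∀ j, γ ∈ (A j).G := fun j => by rwa [hA j]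
  have e : ∀ f : M → E, (∀ j, MemLp (D.localRep j f) p volume) →
      lpClass p (D.localRep i fun y => f (φ γ y)) =
        ∑ j, lpClass p ((A j).pull (b j) (D.localRep j f) γ) := fun f hf => by
    rw [h γ hγ f, lpClass_sum _ fun j => (hb j).memLp_pull hp (hγA j) (hf j)]
  simp only [e u hu, e _ (hv _)]
  exact tendsto_finsetSum _ fun j _ => ((hb j).tendstoLocallyUniformlyOn hp (hu j)
    (fun l => hv l j) (huv j)).tendsto_at (hγA j)

/-- For `u` with localizations in `W^{k+m,p}`, the weak derivatives of order at most `k` of the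
localizations of `u ∘ φ_γ` depend on `γ` in a `C^m` fashion. -/
theorem exists_contDiffOn_hasWeakPartial_comp [CompleteSpace E] (hp : p ≠ ⊤) (hG : IsOpen G)
    (hφ : ContMDiffOn ((𝓡 n).prod (𝓡 2)) (𝓡 2) ∞
      (fun z : EuclideanSpace ℝ (Fin n) × M => φ z.1 z.2) (G ×ˢ univ))
    (hd : ∀ γ ∈ G, ∃ ψ : M ≃ₘ⟮𝓡 2, 𝓡 2⟯ M, ⇑ψ = φ γ) {k m : ℕ} {u : M → E}
    (hu : ∀ j, MemPlaneSobolev (k + m) p (D.localRep j u)) (i : Fin D.card) {j : ℕ} (hj : j ≤ k)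
    (w : Fin j → Fin 2) :
    ∃ h : EuclideanSpace ℝ (Fin n) → Lp E p (volume : Measure Plane), ContDiffOn ℝ m h G ∧
      ∀ γ ∈ G, HasWeakPartial w (D.localRep i fun y => u (φ γ y)) (h γ) := by
  obtain ⟨A, b, hA, hb, h⟩ := exists_planeFamily_sum (E := E) hG hφ hd i
  choose H hH hw using fun l => (hb l).exists_contDiffOn_hasWeakPartial hp m j w
    ((hu l).mono (Nat.add_le_add_right hj m))
  refine ⟨fun γ => ∑ l, H l γ, ContDiffOn.sum fun l _ => hA l ▸ hH l, fun γ hγ => ?_⟩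
  have hγA : ∀ j, γ ∈ (A j).G := fun j => by rwa [hA j]
  rw [h γ hγ u]
  exact HasWeakPartial.sum _ (fun l => (hb l).memLp_pull hp (hγA l) (hu l).1)
    fun l => hw l γ (hγA l)

variable [MeasurableSpace M] [BorelSpace M] [CompleteSpace E]

/-- The diffeomorphisms `φ_γ` preserve null sets, so that `ξ ∘ φ_γ` depends only on the a.e.-class
of `ξ`. -/
theorem ae_eq_comp (hG : IsOpen G)
    (hφ : ContMDiffOn ((𝓡 n).prod (𝓡 2)) (𝓡 2) ∞
      (fun z : EuclideanSpace ℝ (Fin n) × M => φ z.1 z.2) (G ×ˢ univ))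
    (hd : ∀ γ ∈ G, ∃ ψ : M ≃ₘ⟮𝓡 2, 𝓡 2⟯ M, ⇑ψ = φ γ) {γ : EuclideanSpace ℝ (Fin n)} (hγ : γ ∈ G)
    {u v : M → E} (hu : StronglyMeasurable u) (hv : StronglyMeasurable v)
    (huv : u =ᵐ[D.measure] v) :
    (fun y => u (φ γ y)) =ᵐ[D.measure] fun y => v (φ γ y) := by
  obtain ⟨ψ, hψ⟩ := hd γ hγ
  have hm : Measurable (φ γ) := hψ ▸ ψ.continuous.measurable
  exact ae_eq_of_localRep (hu.comp_measurable hm) (hv.comp_measurable hm)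
    (localRep_comp_congr hG hφ hd hγ fun j => localRep_congr D j huv)

/-- The compositions `ξ ∘ φ_γ` with `ξ` in `L^p_{k+m}` belong to `L^p_k`. -/
theorem SobolevSpace.exists_comp (hp : p ≠ ⊤) (hG : IsOpen G)
    (hφ : ContMDiffOn ((𝓡 n).prod (𝓡 2)) (𝓡 2) ∞
      (fun z : EuclideanSpace ℝ (Fin n) × M => φ z.1 z.2) (G ×ˢ univ))
    (hd : ∀ γ ∈ G, ∃ ψ : M ≃ₘ⟮𝓡 2, 𝓡 2⟯ M, ⇑ψ = φ γ) {γ : EuclideanSpace ℝ (Fin n)} (hγ : γ ∈ G)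
    {k m : ℕ} (ξ : SobolevSpace D E (k + m) p) :
    ∃ η : SobolevSpace D E k p, (η : M → E) =ᵐ[D.measure] fun y => ξ (φ γ y) := by
  obtain ⟨ψ, hψ⟩ := hd γ hγ
  have hm : Measurable (φ γ) := hψ ▸ ψ.continuous.measurable
  have hs : AEStronglyMeasurable (fun y => ξ (φ γ y)) D.measure :=
    (ξ.toAEEqFun.stronglyMeasurable.comp_measurable hm).aestronglyMeasurable
  refine ⟨⟨AEEqFun.mk _ hs, fun i => MemPlaneSobolev.congr ⟨memLp_localRep_comp hp hG hφ hd hγ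
    (fun j => (ξ.mem j).1) i, fun j hj w => ?_⟩
    (localRep_congr D i (AEEqFun.coeFn_mk _ hs).symm)⟩, AEEqFun.coeFn_mk _ hs⟩
  obtain ⟨h, -, hw⟩ := exists_contDiffOn_hasWeakPartial_comp hp hG hφ hd ξ.mem i hj w
  exact ⟨h γ, Lp.memLp _, hw γ hγ⟩

/-- Composition with `φ_γ` is a bounded operator between the Sobolev spaces, by the closed graph
theorem. -/
theorem SobolevSpace.exists_clm_comp (hp : p ≠ ⊤) (hG : IsOpen G)
    (hφ : ContMDiffOn ((𝓡 n).prod (𝓡 2)) (𝓡 2) ∞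
      (fun z : EuclideanSpace ℝ (Fin n) × M => φ z.1 z.2) (G ×ˢ univ))
    (hd : ∀ γ ∈ G, ∃ ψ : M ≃ₘ⟮𝓡 2, 𝓡 2⟯ M, ⇑ψ = φ γ) {γ : EuclideanSpace ℝ (Fin n)} (hγ : γ ∈ G)
    (k m : ℕ) : ∃ T : SobolevSpace D E (k + m) p →L[ℝ] SobolevSpace D E k p,
      ∀ ξ, (T ξ : M → E) =ᵐ[D.measure] fun y => ξ (φ γ y) := by
  choose T₀ hT₀ using SobolevSpace.exists_comp (D := D) (E := E) hp hG hφ hd hγ (k := k) (m := m)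
  let T : SobolevSpace D E (k + m) p →ₗ[ℝ] SobolevSpace D E k p :=
    { toFun := T₀
      map_add' := fun ξ η => eq_of_ae_eq <| by
        have h1 := ae_eq_comp hG hφ hd hγ (ξ + η).toAEEqFun.stronglyMeasurable
          (ξ.toAEEqFun.stronglyMeasurable.add η.toAEEqFun.stronglyMeasurable)
          (AEEqFun.coeFn_add ξ.toAEEqFun η.toAEEqFun)
        filter_upwards [hT₀ (ξ + η), hT₀ ξ, hT₀ η, h1,
          AEEqFun.coeFn_add (T₀ ξ).toAEEqFun (T₀ η).toAEEqFun] with y h1 h2 h3 h4 h5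
        refine h1.trans (h4.trans ?_)
        rw [Pi.add_apply, ← h2, ← h3]
        exact h5.symm
      map_smul' := fun c ξ => eq_of_ae_eq <| by
        have h1 := ae_eq_comp hG hφ hd hγ (c • ξ).toAEEqFun.stronglyMeasurable
          (ξ.toAEEqFun.stronglyMeasurable.const_smul c) (AEEqFun.coeFn_smul c ξ.toAEEqFun)
        filter_upwards [hT₀ (c • ξ), hT₀ ξ, h1, AEEqFun.coeFn_smul c (T₀ ξ).toAEEqFun]
          with y h1 h2 h3 h4
        refine h1.trans (h3.trans ?_)
        rw [Pi.smul_apply, ← h2]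
        exact h4.symm }
  have hT : ∀ ξ i, lpClass p (D.localRep i (T ξ)) =
      lpClass p (D.localRep i fun y => ξ (φ γ y)) := fun ξ i =>
    lpClass_congr (localRep_congr D i (hT₀ ξ))
  refine ⟨ContinuousLinearMap.ofSeqClosedGraph (g := T) fun u x y hu hTu =>
    eq_of_lpClass_localRep fun i => ?_, hT₀⟩
  have h1 := tendsto_lpClass (fun l => ((T (u l)).mem i).1) (y.mem i).1
    (tendsto_eLpNorm_localRep hTu i)
  have h2 := tendsto_lpClass_localRep_comp hp hG hφ hd hγ (fun j => (x.mem j).1)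
    (fun l j => ((u l).mem j).1) (tendsto_eLpNorm_localRep hu) i
  rw [hT x i]
  exact tendsto_nhds_unique (h1.congr fun l => hT (u l) i) h2

/-- The action map loses `m` derivatives of the function and gains `m` derivatives in `(γ, ξ)`. -/
theorem SobolevSpace.exists_isActionMap (hp : p ≠ ⊤) (hG : IsOpen G)
    (hφ : ContMDiffOn ((𝓡 n).prod (𝓡 2)) (𝓡 2) ∞
      (fun z : EuclideanSpace ℝ (Fin n) × M => φ z.1 z.2) (G ×ˢ univ))
    (hd : ∀ γ ∈ G, ∃ ψ : M ≃ₘ⟮𝓡 2, 𝓡 2⟯ M, ⇑ψ = φ γ) (k m : ℕ) :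
    ∃ Φ : EuclideanSpace ℝ (Fin n) × SobolevSpace D E (k + m) p → SobolevSpace D E k p,
      IsActionMap D G φ Φ ∧ ContDiffOn ℝ m Φ (G ×ˢ univ) := by
  have key : ∀ γ, ∃ T : SobolevSpace D E (k + m) p →L[ℝ] SobolevSpace D E k p,
      γ ∈ G → ∀ ξ, (T ξ : M → E) =ᵐ[D.measure] fun y => ξ (φ γ y) := fun γ => by
    by_cases hγ : γ ∈ G
    · obtain ⟨T, hT⟩ := exists_clm_comp (D := D) (E := E) hp hG hφ hd hγ k m
      exact ⟨T, fun _ => hT⟩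
    · exact ⟨0, fun h => absurd h hγ⟩
  choose T hT using key
  -- derivatives of the orbits can be computed on jets, that is, componentwise in `L^p`
  refine ⟨fun z => T z.1 z.2, fun γ hγ ξ => hT γ hγ ξ, contDiffOn_prod_apply hG m fun ξ => ?_⟩
  refine contDiffOn_of_linearIsometry_comp hG m (jetₗᵢ D E p k) ((contDiffOn_piLp p).2 fun a => ?_)
  obtain ⟨h, hs, hw⟩ := exists_contDiffOn_hasWeakPartial_comp hp hG hφ hd ξ.mem a.1
    (Nat.lt_succ_iff.1 a.2.1.2) a.2.2
  refine hs.congr fun γ hγ => Lp.ext ?_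
  exact (T γ ξ).partialLp_eq a (Lp.memLp _)
    ((hw γ hγ).congr (localRep_congr D a.1 (hT γ hγ ξ).symm))

end Action

theorem theorem1p1 {M : Type*} [TopologicalSpace M] [CompactSpace M] [T2Space M]
    [ChartedSpace Plane M] [IsManifold (𝓡 2) ∞ M] [MeasurableSpace M] [BorelSpace M]
    (D : SobolevAtlas M) (p : ℝ≥0∞) [Fact (1 ≤ p)] (hp : p ≠ ⊤) (n N : ℕ)
    (ε : ℝ) (hε : 0 < ε) (φ : EuclideanSpace ℝ (Fin n) → M → M)
    (hφ : ContMDiffOn ((𝓡 n).prod (𝓡 2)) (𝓡 2) ∞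
      (fun z : EuclideanSpace ℝ (Fin n) × M => φ z.1 z.2) (Metric.ball 0 ε ×ˢ univ))
    (hdiffeo : ∀ γ ∈ Metric.ball (0 : EuclideanSpace ℝ (Fin n)) ε,
      ∃ ψ : M ≃ₘ⟮𝓡 2, 𝓡 2⟯ M, ⇑ψ = φ γ) :
    (∀ k m : ℕ,
      ∃ Φ : EuclideanSpace ℝ (Fin n) × SobolevSpace D (EuclideanSpace ℝ (Fin N)) (k + m) p →
          SobolevSpace D (EuclideanSpace ℝ (Fin N)) k p,
        IsActionMap D (Metric.ball 0 ε) φ Φ ∧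
          ContDiffOn ℝ m Φ (Metric.ball 0 ε ×ˢ univ)) ∧
    (∀ k m : ℕ, 0 < (k : ℝ) - m - 2 / p.toReal →
      ∃ Φ : EuclideanSpace ℝ (Fin n) × SobolevSpace D (EuclideanSpace ℝ (Fin N)) k p →
          SobolevSpace D (EuclideanSpace ℝ (Fin N)) (k - m) p,
        IsActionMap D (Metric.ball 0 ε) φ Φ ∧
          ContDiffOn ℝ m Φ (Metric.ball 0 ε ×ˢ univ)) := by
  have key : ∀ k m : ℕ,
      ∃ Φ : EuclideanSpace ℝ (Fin n) × SobolevSpace D (EuclideanSpace ℝ (Fin N)) (k + m) p →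
          SobolevSpace D (EuclideanSpace ℝ (Fin N)) k p,
        IsActionMap D (Metric.ball 0 ε) φ Φ ∧ ContDiffOn ℝ m Φ (Metric.ball 0 ε ×ˢ univ) :=
    SobolevSpace.exists_isActionMap hp Metric.isOpen_ball hφ hdiffeo
  refine ⟨key, fun k m hkm => ?_⟩
  have hmk : m ≤ k := by
    have h1 : (0 : ℝ) ≤ 2 / p.toReal := by positivity
    exact_mod_cast (by linarith : (m : ℝ) ≤ k)
  obtain ⟨l, rfl⟩ := Nat.exists_eq_add_of_le' hmk
  rw [Nat.add_sub_cancel]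
  exact key l m
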